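/- Let $d\ge 1$ and let $\mathsf M$ be a random $L^2$ wide-sense stationary signed measure on $\mathbb R^d$: a family of real square-integrable random variables $I_{\mathsf M}(f)$, indexed by the bounded measurable compactly supported functions $f:\mathbb R^d\to\mathbb R$, almost surely linear and $\sigma$-additive in $f$, whose mean and variance are unchanged when $f$ is translated. Let $\mathsf S$ be its spectral measure, a non-negative Borel measure on $\mathbb R^d$ with $\operatorname{Var}(I_{\mathsf M}(f))=\int|\hat f|^2\,d\mathsf S$ for all such $f$, where $\hat f(u)=\int e^{-i\langle u,t\rangle}f(t)\,dt$, and let $\mathsf s\ge 0$ be its spectral density, i.e. a measurable density of the absolutely continuous part of $\mathsf S$. Put $$\tilde{\mathsf s}(u)=\sup_{\|v\|=\|u\|}\mathsf s(v)\in[0,\infty],$$ with $1/0=\infty$ and $1/\infty=0$. For $\mathbf k\in\mathbb N^d$ write $u^{\mathbf k}=\prod_i u_i^{k_i}$ and $|\mathbf k|=\sum_i k_i$. Say that $\mathsf s^{-1}$ has a *pole of order* $\mathbf k$ (at $0$) if every polynomial $Q(u)=\sum_{\mathbf m}a_{\mathbf m}u^{\mathbf m}$ with complex coefficients such that $\int_{B(0,\varepsilon)}|Q|^2\mathsf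 s^{-1}\,du<\infty$ for some $\varepsilon>0$ satisfies $a_{\mathbf k}=0$. For $A\subset\mathbb R^d$ bounded and measurable, say that $\mathsf M$ is $\mathbf k$-*rigid* on $A$ if there are bounded measurable compactly supported functions $h_n$ vanishing on $A$ such that $I_{\mathsf M}(h_n)\to I_{\mathsf M}(t^{\mathbf k}\mathbf 1_A(t))$ almost surely and in $L^2$. Let $\mathbf k\in\mathbb N^d$. 1. For every $\varepsilon>0$, $$\int_{B(0,\varepsilon)}\tilde{\mathsf s}^{-1}(u)\,u^{2\mathbf k}\,du=\infty\quad\Longleftrightarrow\quad\int_{B(0,\varepsilon)}\tilde{\mathsf s}^{-1}(u)\,\|u\|^{2|\mathbf k|}\,du=\infty .$$ 2. If $\int_{B(0,\varepsilon)}\tilde{\mathsf s}^{-1}(u)\|u\|^{2|\mathbf k|}\,du=\infty$ for every $\varepsilon>0$, then $\mathsf s^{-1}$ has a pole of order $\mathbf k$, and $\mathsf M$ is $\mathbf k$-rigid on every bounded measurable set $A\subset\mathbb R^d$. More generally, both hold with $\mathbf k$ replaced by any $\mathbf m\in\mathbb N^d$ with $|\mathbf m|\le|\mathbf k|$. 3.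 If $\mathsf s$ is isotropic, i.e. $\mathsf s(u)$ depends only on $\|u\|$, then $\tilde{\mathsf s}=\mathsf s$; hence the conclusions of 2 hold as soon as $\int_{B(0,\varepsilon)}\mathsf s^{-1}(u)\,u^{2\mathbf k}\,du=\infty$ for every $\varepsilon>0$. -/

import Mathlib

open MeasureTheory ProbabilityTheory Filter Topology
open scoped ENNReal

/-- The Euclidean space `ℝ^d`. -/
abbrev Rd (d : ℕ) : Type := EuclideanSpace ℝ (Fin d)

/-- The length `|k| = k_1 + ... + k_d` of a multi-index. -/
def multiLength {d : ℕ} (k : Fin d →₀ ℕ) : ℕ := ∑ i, k i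

/-- The monomial `t^k = ∏ i, t_i ^ k_i`. -/
def monomialFun {d : ℕ} (k : Fin d →₀ ℕ) (t : Rd d) : ℝ := ∏ i, t i ^ k i

/-- Test functions: measurable, bounded, compactly supported real functions on `ℝ^d`. -/
structure IsTestFun {d : ℕ} (f : Rd d → ℝ) : Prop where
  measurable : Measurable f
  bounded : ∃ C : ℝ, ∀ t, |f t| ≤ C
  compactSupport : HasCompactSupport f

/-- A random `L²` wide-sense stationary signed measure on `ℝ^d`, given through its linear
statistics `I f`: real square-integrable random variables indexed by the test functions `f`
(values of `I` elsewhere are irrelevant), almost surely linear and countably additive in `f`, whose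
means and variances do not change when `f` is translated. -/
structure IsStationaryRandomMeasure {d : ℕ} {Ω : Type*} [MeasurableSpace Ω] (P : Measure Ω)
    (I : (Rd d → ℝ) → Ω → ℝ) : Prop where
  memLp : ∀ f, IsTestFun f → MemLp (I f) 2 P
  add : ∀ f g, IsTestFun f → IsTestFun g → I (f + g) =ᵐ[P] I f + I g
  smul : ∀ (c : ℝ) f, IsTestFun f → I (c • f) =ᵐ[P] c • I f
  sigma_additive : ∀ (f : ℕ → Rd d → ℝ) (g : Rd d → ℝ), (∀ n, IsTestFun (f n)) → IsTestFun g →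
    (∀ n t, 0 ≤ f n t) → (∀ t, HasSum (fun n => f n t) (g t)) →
    ∀ᵐ ω ∂P, Tendsto (fun N => ∑ n ∈ Finset.range N, I (f n) ω) atTop (𝓝 (I g ω))
  mean_translate : ∀ (x : Rd d) f, IsTestFun f →
    ∫ ω, I (fun t => f (t - x)) ω ∂P = ∫ ω, I f ω ∂P
  variance_translate : ∀ (x : Rd d) f, IsTestFun f →
    variance (I (fun t => f (t - x))) P = variance (I f) P

/-- The Fourier transform `f̂(u) = ∫ exp(-i⟨u,t⟩) f(t) dt`. -/
noncomputable def fourierHat {d : ℕ} (f : Rd d → ℝ) (u : Rd d) : ℂ :=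
  ∫ t, Complex.exp (-(Complex.I * ((inner ℝ u t : ℝ) : ℂ))) * (f t : ℂ)

/-- `S` is a spectral measure of the random measure: `Var(I f) = ∫ |f̂|² dS` for all test `f`. -/
def IsSpectralMeasure {d : ℕ} {Ω : Type*} [MeasurableSpace Ω] (P : Measure Ω)
    (I : (Rd d → ℝ) → Ω → ℝ) (S : Measure (Rd d)) : Prop :=
  ∀ f, IsTestFun f → evariance (I f) P = ∫⁻ u, ‖fourierHat f u‖ₑ ^ 2 ∂S

/-- `s` is a density, with respect to Lebesgue measure, of the absolutely continuous part of `S`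
(Lebesgue decomposition). -/
def IsSpectralDensity {d : ℕ} (S : Measure (Rd d)) (s : Rd d → ℝ≥0∞) : Prop :=
  Measurable s ∧ ∃ ν : Measure (Rd d), ν ⟂ₘ (volume : Measure (Rd d)) ∧
    S = ν + (volume : Measure (Rd d)).withDensity s

/-- `w` (to be thought of as `s⁻¹`) has a pole of order `k` at `0`: the coefficient of `u^k` vanishes
in every polynomial `Q` such that `|Q|² w` is integrable on some ball around `0`. -/
def HasPoleOfOrder {d : ℕ} (w : Rd d → ℝ≥0∞) (k : Fin d →₀ ℕ) : Prop :=
  ∀ Q : MvPolynomial (Fin d) ℂ,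
    (∃ ε : ℝ, 0 < ε ∧
      ∫⁻ u in Metric.ball (0 : Rd d) ε, ‖MvPolynomial.eval (fun i => (u i : ℂ)) Q‖ₑ ^ 2 * w u < ∞) →
    Q.coeff k = 0

/-- `s̃(u) = sup {s(v) : ‖v‖ = ‖u‖}`, possibly `∞`. -/
noncomputable def radialSup {d : ℕ} (s : Rd d → ℝ≥0∞) (u : Rd d) : ℝ≥0∞ :=
  ⨆ (v : Rd d) (_ : ‖v‖ = ‖u‖), s v

/-- `s(u)` only depends on `‖u‖`. -/
def IsIsotropic {d : ℕ} (s : Rd d → ℝ≥0∞) : Prop := ∀ u v, ‖u‖ = ‖v‖ → s u = s v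

/-- Linear `γ`-rigidity on `A`: `I(γ 1_A)` is the limit, in `L²` and almost surely, of statistics
`I(h_n)` where the test functions `h_n` vanish on `A`. -/
def IsLinearlyRigid {d : ℕ} {Ω : Type*} [MeasurableSpace Ω] (P : Measure Ω)
    (I : (Rd d → ℝ) → Ω → ℝ) (γ : Rd d → ℝ) (A : Set (Rd d)) : Prop :=
  ∃ h : ℕ → Rd d → ℝ, (∀ n, IsTestFun (h n) ∧ ∀ t ∈ A, h n t = 0) ∧
    Tendsto (fun n => eLpNorm (I (h n) - I (A.indicator γ)) 2 P) atTop (𝓝 0) ∧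
    ∀ᵐ ω ∂P, Tendsto (fun n => I (h n) ω) atTop (𝓝 (I (A.indicator γ) ω))

/-- `k`-rigidity on `A` for a multi-index `k`. -/
def IsMultiRigid {d : ℕ} {Ω : Type*} [MeasurableSpace Ω] (P : Measure Ω)
    (I : (Rd d → ℝ) → Ω → ℝ) (k : Fin d →₀ ℕ) (A : Set (Rd d)) : Prop :=
  IsLinearlyRigid P I (monomialFun k) A

/-! Everything rests on one growth principle. Let `w` be a radial weight with `w ‖u‖^(2N)` not
integrable near `0`, and let `G` agree with a polynomial up to `O(‖u‖^(N+1))`. If `|G|² w` is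
integrable near `0`, the polynomial has no term of degree at most `N`. Indeed, if `P` is its lowest
nonzero homogeneous component, of degree `j ≤ N`, then for small `r` the mean of `|G|²` over the
sphere of radius `r` is at least a positive constant times `r^(2j)`, because `P` does not vanish
identically on the unit sphere. Since `w` is radial, this bound on spherical means transfers to the
weighted integral (`setLIntegral_radial_mul_le`,
`homogeneousComponent_eq_zero_of_lintegral_lt_top`). Poles follow with `G` the polynomial itself, as
`1/s̃ ≤ 1/s`. The equivalence of the two integral conditions is the same comparison of spherical
means.

Rigidity is a statement of Hilbert space duality: every `X` in `L²` orthogonal to the statistics of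
test functions vanishing on `A` must be orthogonal to `I(t^m 1_A)`. For such an `X`, `f ↦ E[X I(f)]`
depends only on `f` on `A`. By the closed graph theorem it gives a continuous functional on `C(K)`,
with `K` a ball containing `A`; let `L` be its complexification and `M(u) = L(exp(i⟨u,·⟩))`. The
Taylor coefficients of `M` at `0` are nonzero multiples of the moments `L(t^m)`, so it suffices that
`|M|²/s̃` is integrable near `0`.

To see this, take a smooth window `f`. Fourier inversion turns `E[X I(f(·-x))]` into the integral of
`wave x` against `F = c f̂ M`. Cauchy–Schwarz and the spectral identity bound the resulting
functional on trigonometric polynomials by the `L²` norm of a finite measure: `|f̂|² S` plus an atom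
at `0` for the mean, symmetrized because only real statistics are available. Such a bound forces
`|F|²` divided by the density of that measure to be integrable (`lintegral_enorm_sq_mul_inv_le`).
The density is `|f̂(u)|² (s(u) + s(-u))`, at most `2 |f̂|² s̃`, and `f̂` does not vanish near `0`.
-/

/-! ### Polar coordinates and radial weights. -/

section Polar

variable {E : Type*} [NormedAddCommGroup E] [NormedSpace ℝ E] [MeasurableSpace E] [BorelSpace E]
  [FiniteDimensional ℝ E] [Nontrivial E] (μ : Measure E) [μ.IsAddHaarMeasure]

/-- Integration in polar coordinates. -/
theorem lintegral_polar {f : E → ℝ≥0∞} (hf : Measurable f) :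
    ∫⁻ u, f u ∂μ = ∫⁻ r : Set.Ioi (0 : ℝ), ∫⁻ θ, f (r.1 • θ.1) ∂μ.toSphere
      ∂(Measure.volumeIoiPow (Module.finrank ℝ E - 1)) := by
  have h1 : ∫⁻ u, f u ∂μ = ∫⁻ x : ({(0)}ᶜ : Set E), f x.1 ∂(μ.comap (↑)) := by
    rw [lintegral_subtype_comap (measurableSet_singleton _).compl f, restrict_compl_singleton]
  have h2 : Measurable (fun p : Metric.sphere (0 : E) 1 × Set.Ioi (0 : ℝ) => f (p.2.1 • p.1.1)) := by
    fun_prop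
  rw [h1, ← lintegral_prod_symm _ h2.aemeasurable,
    ← (μ.measurePreserving_homeomorphUnitSphereProd).lintegral_comp h2]
  refine lintegral_congr fun x => ?_
  congr 1
  have hx : ‖(x : E)‖ ≠ 0 := norm_ne_zero_iff.2 x.2
  simp [smul_smul, hx]

/-- A lower bound on spherical means of `p` carries over to integrals against a radial weight `w`,
which need not be measurable. -/
theorem setLIntegral_radial_mul_le {w : E → ℝ≥0∞} (hw : ∀ u v, ‖u‖ = ‖v‖ → w u = w v)
    {p : E → ℝ≥0∞} (hp : Measurable p) {q : ℝ → ℝ≥0∞} (hq : Measurable q) {ε : ℝ}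
    (hq0 : ∀ r, 0 < r → r < ε → q r ≠ 0) (hqt : ∀ r, 0 < r → r < ε → q r ≠ ∞)
    (hqp : ∀ r, 0 < r → r < ε → q r ≤ ∫⁻ θ, p (r • θ.1) ∂μ.toSphere) :
    ∫⁻ u in Metric.ball (0 : E) ε, w u * q ‖u‖ ∂μ ≤
      μ.toSphere Set.univ * ∫⁻ u in Metric.ball (0 : E) ε, w u * p u ∂μ := by
  -- As `w` may fail to be measurable, the integrand is replaced by a measurable minorant with the
  -- same integral; the spherical integral `Ψ` of `g / q` then serves as a measurable radial
  -- substitute for `w`, up to the mass of the sphere.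
  obtain ⟨g, hg, hgle, hgeq⟩ := exists_measurable_le_lintegral_eq
    (μ.restrict (Metric.ball (0 : E) ε)) (fun u => w u * q ‖u‖)
  have hψ : Measurable fun u : E => g u / q ‖u‖ := by fun_prop
  set Ψ : ℝ → ℝ≥0∞ := fun r => ∫⁻ θ, g (r • θ.1) / q ‖r • θ.1‖ ∂μ.toSphere with hΨ
  have hΨm : Measurable Ψ := by
    have : Measurable fun x : ℝ × Metric.sphere (0 : E) 1 => g (x.1 • x.2.1) / q ‖x.1 • x.2.1‖ :=
      hψ.comp (by fun_prop)
    exact this.lintegral_prod_right'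
  have hΨw : ∀ u : E, u ≠ 0 → ‖u‖ < ε → Ψ ‖u‖ ≤ w u * μ.toSphere Set.univ := by
    intro u hu huε
    rw [← lintegral_const]
    refine lintegral_mono fun θ => ?_
    have hn : ‖‖u‖ • θ.1‖ = ‖u‖ := by simp [norm_smul]
    refine ENNReal.div_le_of_le_mul ?_
    rw [← hw _ u hn]
    exact hgle _
  have hB : MeasurableSet (Metric.ball (0 : E) ε) := measurableSet_ball
  calc ∫⁻ u in Metric.ball (0 : E) ε, w u * q ‖u‖ ∂μ
      = ∫⁻ u in Metric.ball (0 : E) ε, g u ∂μ := hgeq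
    _ = ∫⁻ u, (Metric.ball (0 : E) ε).indicator g u ∂μ := (lintegral_indicator hB _).symm
    _ ≤ ∫⁻ u, (Metric.ball (0 : E) ε).indicator (fun u => Ψ ‖u‖ * p u) u ∂μ := by
        rw [lintegral_polar μ (hg.indicator hB),
          lintegral_polar μ (Measurable.indicator (by fun_prop) hB)]
        refine lintegral_mono fun r => ?_
        have hr : 0 < r.1 := r.2
        have hn : ∀ θ : Metric.sphere (0 : E) 1, ‖r.1 • θ.1‖ = r.1 := fun θ => by
          simp [norm_smul, abs_of_pos hr]
        by_cases hrε : r.1 < ε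
        · have hmem : ∀ θ : Metric.sphere (0 : E) 1, r.1 • θ.1 ∈ Metric.ball (0 : E) ε := fun θ => by
            rw [mem_ball_zero_iff, hn]; exact hrε
          simp only [Set.indicator_of_mem (hmem _), hn]
          have hpm : Measurable fun θ : Metric.sphere (0 : E) 1 => p (r.1 • θ.1) := by fun_prop
          rw [lintegral_const_mul _ hpm]
          refine le_trans ?_ (mul_le_mul_right (hqp _ hr hrε) (Ψ r.1))
          rw [hΨ]
          simp only [hn]
          have hgm : Measurable fun θ : Metric.sphere (0 : E) 1 => g (r.1 • θ.1) / q r.1 := by fun_prop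
          rw [← lintegral_mul_const _ hgm]
          refine lintegral_mono fun θ => ?_
          rw [ENNReal.div_mul_cancel (hq0 _ hr hrε) (hqt _ hr hrε)]
        · have hmem : ∀ θ : Metric.sphere (0 : E) 1, r.1 • θ.1 ∉ Metric.ball (0 : E) ε := fun θ => by
            rw [mem_ball_zero_iff, hn]; exact hrε
          simp [Set.indicator_of_notMem (hmem _)]
    _ = ∫⁻ u in Metric.ball (0 : E) ε, Ψ ‖u‖ * p u ∂μ := lintegral_indicator hB _
    _ ≤ ∫⁻ u in Metric.ball (0 : E) ε, μ.toSphere Set.univ * (w u * p u) ∂μ := by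
        refine lintegral_mono_ae ?_
        have h0 : ∀ᵐ u ∂μ, u ≠ (0 : E) := by simp [ae_iff]
        filter_upwards [ae_restrict_mem hB, ae_restrict_of_ae h0] with u hu hu0
        rw [← mul_assoc, mul_comm (μ.toSphere Set.univ)]
        exact mul_le_mul_left (hΨw u hu0 (mem_ball_zero_iff.1 hu)) _
    _ = _ := lintegral_const_mul' _ _ (measure_ne_top _ _)

end Polar

/-! ### Monomials and the equivalence of the two integral conditions. -/

section Monomials

variable {d : ℕ}

theorem multiLength_eq_degree (k : Fin d →₀ ℕ) : multiLength k = k.degree :=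
  (Finsupp.degree_eq_sum k).symm

theorem measurable_monomialFun (k : Fin d →₀ ℕ) : Measurable (monomialFun k) := by
  unfold monomialFun; fun_prop

theorem continuous_monomialFun (k : Fin d →₀ ℕ) : Continuous (monomialFun k) := by
  unfold monomialFun; fun_prop

theorem abs_monomialFun_le (k : Fin d →₀ ℕ) (u : Rd d) : |monomialFun k u| ≤ ‖u‖ ^ multiLength k := by
  unfold monomialFun multiLength
  rw [Finset.abs_prod, ← Finset.prod_pow_eq_pow_sum]
  refine Finset.prod_le_prod (fun _ _ => abs_nonneg _) fun i _ => ?_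
  rw [abs_pow]
  exact pow_le_pow_left₀ (abs_nonneg _) (PiLp.norm_apply_le u i) _

theorem monomialFun_smul (k : Fin d →₀ ℕ) (r : ℝ) (u : Rd d) :
    monomialFun k (r • u) = r ^ multiLength k * monomialFun k u := by
  unfold monomialFun multiLength
  simp [mul_pow, Finset.prod_mul_distrib, Finset.prod_pow_eq_pow_sum]

theorem multiLength_two_nsmul (k : Fin d →₀ ℕ) : multiLength (2 • k) = 2 * multiLength k := by
  simp [multiLength, Finset.mul_sum]

theorem radialSup_radial (s : Rd d → ℝ≥0∞) (u v : Rd d) (h : ‖u‖ = ‖v‖) :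
    radialSup s u = radialSup s v := by
  unfold radialSup; rw [h]

theorem le_radialSup (s : Rd d → ℝ≥0∞) {u v : Rd d} (h : ‖v‖ = ‖u‖) : s v ≤ radialSup s u :=
  le_iSup₂_of_le v h le_rfl

theorem radialSup_eq_of_isotropic {s : Rd d → ℝ≥0∞} (h : IsIsotropic s) : radialSup s = s :=
  funext fun u => le_antisymm (iSup₂_le fun v hv => (h v u hv).le) (le_radialSup s rfl)

/-- Against a radial weight, `u ^ (2k)` and `‖u‖ ^ (2|k|)` have infinite integral simultaneously. -/
theorem setLIntegral_monomial_eq_top_iff (hd : 0 < d) {w : Rd d → ℝ≥0∞}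
    (hw : ∀ u v, ‖u‖ = ‖v‖ → w u = w v) (k : Fin d →₀ ℕ) (ε : ℝ) :
    ∫⁻ u in Metric.ball (0 : Rd d) ε, w u * ENNReal.ofReal (monomialFun (2 • k) u) = ∞ ↔
      ∫⁻ u in Metric.ball (0 : Rd d) ε, w u * ENNReal.ofReal (‖u‖ ^ (2 * multiLength k)) = ∞ := by
  have : Nonempty (Fin d) := ⟨⟨0, hd⟩⟩
  constructor
  · intro h
    refine top_unique (h ▸ lintegral_mono fun u => ?_)
    gcongr
    rw [← multiLength_two_nsmul]
    exact (le_abs_self _).trans (abs_monomialFun_le _ u)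
  · intro h
    set σ := (volume : Measure (Rd d)).toSphere
    have hcont : Continuous fun θ : Metric.sphere (0 : Rd d) 1 =>
        ENNReal.ofReal (monomialFun (2 • k) θ.1) :=
      ENNReal.continuous_ofReal.comp ((continuous_monomialFun _).comp continuous_subtype_val)
    set κ := ∫⁻ θ, ENNReal.ofReal (monomialFun (2 • k) θ.1) ∂σ with hκ
    have hκ0 : κ ≠ 0 := by
      -- No coordinate of this vector is zero, so the monomial is positive at its normalization and,
      -- by continuity, on a nonempty open part of the sphere.
      let v : Rd d := WithLp.toLp 2 fun _ => 1
      have hv : v ≠ 0 := fun h0 => by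
        have := congrArg (fun x : Rd d => x ⟨0, hd⟩) h0
        simp [v] at this
      have hpos : 0 < monomialFun (2 • k) (‖v‖⁻¹ • v) := by
        rw [monomialFun_smul]
        have : monomialFun (2 • k) v = 1 := by simp [monomialFun, v]
        rw [this]
        positivity
      refine ne_of_gt ?_
      rw [hκ, lintegral_pos_iff_support hcont.measurable]
      refine hcont.isOpen_support.measure_pos _ ⟨⟨‖v‖⁻¹ • v, ?_⟩, ?_⟩
      · simp [norm_smul, hv]
      · simpa using hpos
    have hκt : κ ≠ ∞ := by
      have : κ ≤ ∫⁻ θ, 1 ∂σ := lintegral_mono fun θ => by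
        rw [← ENNReal.ofReal_one]
        refine ENNReal.ofReal_le_ofReal ((le_abs_self _).trans ((abs_monomialFun_le _ _).trans ?_))
        simp
      exact ne_top_of_le_ne_top (by simp) this
    have key := setLIntegral_radial_mul_le volume hw
      (p := fun u => ENNReal.ofReal (monomialFun (2 • k) u))
      (q := fun r => ENNReal.ofReal (r ^ (2 * multiLength k)) * κ) (ε := ε)
      ((measurable_monomialFun _).ennreal_ofReal) (by fun_prop)
      (fun r hr _ => mul_ne_zero (by simpa using pow_pos hr _) hκ0)
      (fun r _ _ => ENNReal.mul_ne_top ENNReal.ofReal_ne_top hκt)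
      (fun r hr _ => by
        simp only [monomialFun_smul, multiLength_two_nsmul]
        simp only [ENNReal.ofReal_mul (pow_nonneg hr.le _)]
        rw [lintegral_const_mul _ hcont.measurable])
    simp only [← mul_assoc] at key
    rw [lintegral_mul_const' _ _ hκt, h, ENNReal.top_mul hκ0, top_le_iff, ENNReal.mul_eq_top] at key
    rcases key with ⟨_, h⟩ | ⟨h, _⟩
    · exact h
    · exact absurd h (measure_ne_top _ _)

end Monomials

/-! ### Vanishing of low-degree Taylor terms, and poles. -/

section Poles

variable {d : ℕ}

/-- A polynomial without terms of degree less than `n` is `O(‖u‖ ^ n)` on the unit ball. -/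
theorem exists_norm_eval_le (R : MvPolynomial (Fin d) ℂ) (n : ℕ)
    (hR : ∀ m ∈ R.support, n ≤ m.degree) :
    ∃ C : ℝ, 0 ≤ C ∧ ∀ u : Rd d, ‖u‖ ≤ 1 →
      ‖MvPolynomial.eval (fun i => (u i : ℂ)) R‖ ≤ C * ‖u‖ ^ n := by
  refine ⟨∑ m ∈ R.support, ‖R.coeff m‖, Finset.sum_nonneg fun _ _ => norm_nonneg _, fun u hu => ?_⟩
  rw [MvPolynomial.eval_eq', Finset.sum_mul]
  refine norm_sum_le_of_le _ fun m hm => ?_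
  rw [norm_mul]
  gcongr
  have h1 : ‖∏ i, (u i : ℂ) ^ m i‖ = |monomialFun m u| := by
    simp [monomialFun, Finset.abs_prod]
  rw [h1]
  refine (abs_monomialFun_le m u).trans ?_
  rw [multiLength_eq_degree]
  exact pow_le_pow_of_le_one (norm_nonneg _) hu (hR m hm)

theorem eval_smul_of_isHomogeneous {P : MvPolynomial (Fin d) ℂ} {j : ℕ} (hP : P.IsHomogeneous j)
    (r : ℝ) (u : Rd d) :
    MvPolynomial.eval (fun i => ((r • u) i : ℂ)) P =
      (r : ℂ) ^ j * MvPolynomial.eval (fun i => (u i : ℂ)) P := by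
  rw [MvPolynomial.eval_eq', MvPolynomial.eval_eq', Finset.mul_sum]
  refine Finset.sum_congr rfl fun m hm => ?_
  have hdeg : ∑ i, m i = j := by
    rw [← Finsupp.degree_eq_sum]
    by_contra h
    exact MvPolynomial.mem_support_iff.1 hm (hP.coeff_eq_zero h)
  simp only [PiLp.smul_apply, smul_eq_mul, Complex.ofReal_mul, mul_pow, Finset.prod_mul_distrib,
    Finset.prod_pow_eq_pow_sum, hdeg]
  ring

/-- By homogeneity, vanishing on the sphere propagates to the open positive orthant, a product of
infinite sets, on which only the zero polynomial vanishes. -/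
theorem exists_sphere_eval_ne_zero (hd : 0 < d) {P : MvPolynomial (Fin d) ℂ} {j : ℕ}
    (hP : P.IsHomogeneous j) (hP0 : P ≠ 0) :
    ∃ θ : Metric.sphere (0 : Rd d) 1, MvPolynomial.eval (fun i => (θ.1 i : ℂ)) P ≠ 0 := by
  by_contra! hcon
  apply hP0
  refine MvPolynomial.funext_set (fun _ => Complex.ofReal '' Set.Ioi (0 : ℝ))
    (fun _ => (Set.Ioi_infinite 0).image Complex.ofReal_injective.injOn) ?_
  intro x hx
  choose y hy hyx using fun i => hx i (Set.mem_univ i)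
  let u : Rd d := WithLp.toLp 2 y
  have hu : u ≠ 0 := fun h0 => by
    have := congrArg (fun x : Rd d => x ⟨0, hd⟩) h0
    exact (hy ⟨0, hd⟩).ne' this
  have hn : ‖u‖ ≠ 0 := norm_ne_zero_iff.2 hu
  have h1 := hcon ⟨‖u‖⁻¹ • u, by simp [norm_smul, hn]⟩
  have h2 := eval_smul_of_isHomogeneous hP ‖u‖ (‖u‖⁻¹ • u)
  rw [h1, mul_zero, smul_smul, mul_inv_cancel₀ hn, one_smul] at h2
  rw [map_zero, ← h2]
  congr 1
  exact congrArg (fun z => MvPolynomial.eval z) (funext fun i => (hyx i).symm)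

theorem continuous_eval_ofReal (P : MvPolynomial (Fin d) ℂ) :
    Continuous fun u : Rd d => MvPolynomial.eval (fun i => (u i : ℂ)) P :=
  (MvPolynomial.continuous_eval P).comp (by fun_prop)

/-- If `|G|²` is integrable near `0` against a radial weight `w` for which `‖u‖ ^ (2N)` is not, then
the Taylor polynomial of `G` at `0` has no terms of degree at most `N`. -/
theorem homogeneousComponent_eq_zero_of_lintegral_lt_top (hd : 0 < d) {w : Rd d → ℝ≥0∞}
    (hw : ∀ u v, ‖u‖ = ‖v‖ → w u = w v) {N : ℕ}
    (hwN : ∀ ε : ℝ, 0 < ε →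
      ∫⁻ u in Metric.ball (0 : Rd d) ε, w u * ENNReal.ofReal (‖u‖ ^ (2 * N)) = ∞)
    {G : Rd d → ℂ} (hG : Measurable G) (Q : MvPolynomial (Fin d) ℂ) {C δ : ℝ} (hδ : 0 < δ)
    (hGQ : ∀ u, ‖u‖ < δ → ‖G u - MvPolynomial.eval (fun i => (u i : ℂ)) Q‖ ≤ C * ‖u‖ ^ (N + 1))
    (hfin : ∫⁻ u in Metric.ball (0 : Rd d) δ, w u * ‖G u‖ₑ ^ 2 < ∞) {j : ℕ} (hj : j ≤ N) :
    MvPolynomial.homogeneousComponent j Q = 0 := by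
  have : Nonempty (Fin d) := ⟨⟨0, hd⟩⟩
  induction j using Nat.strong_induction_on with
  | _ j ih =>
  by_contra hP0
  set P := MvPolynomial.homogeneousComponent j Q with hPdef
  have hPh : P.IsHomogeneous j := MvPolynomial.homogeneousComponent_isHomogeneous j Q
  -- Components of degree below `j` vanish by induction and the one of degree `j` cancels, so `Q -
  -- P` starts in degree `j + 1`.
  obtain ⟨C', hC', hR⟩ := exists_norm_eval_le (Q - P) (j + 1) (by
    intro m hm
    by_contra! hlt
    refine MvPolynomial.mem_support_iff.1 hm ?_
    rw [MvPolynomial.coeff_sub, hPdef, MvPolynomial.coeff_homogeneousComponent]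
    split_ifs with h
    · simp
    · have := ih m.degree (by omega) (by omega)
      have h2 := congrArg (MvPolynomial.coeff m) this
      rw [MvPolynomial.coeff_homogeneousComponent, if_pos rfl] at h2
      simpa using h2)
  set D := |C| + C' with hD
  have hD0 : 0 ≤ D := by positivity
  have hbound : ∀ u : Rd d, ‖u‖ < δ → ‖u‖ ≤ 1 →
      ‖MvPolynomial.eval (fun i => (u i : ℂ)) P‖ ^ 2 ≤
        2 * ‖G u‖ ^ 2 + 2 * D ^ 2 * (‖u‖ ^ (2 * j) * ‖u‖ ^ 2) := by
    intro u hu hu1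
    have h1 := hGQ u hu
    have h2 := hR u hu1
    have h3 : ‖u‖ ^ (N + 1) ≤ ‖u‖ ^ (j + 1) := pow_le_pow_of_le_one (norm_nonneg _) hu1 (by omega)
    have h4 : C * ‖u‖ ^ (N + 1) ≤ |C| * ‖u‖ ^ (j + 1) :=
      mul_le_mul (le_abs_self C) h3 (by positivity) (abs_nonneg C)
    rw [map_sub] at h2
    set z := MvPolynomial.eval (fun i => (u i : ℂ)) Q
    set p := MvPolynomial.eval (fun i => (u i : ℂ)) P
    have h5 : ‖p‖ ≤ ‖G u‖ + D * ‖u‖ ^ (j + 1) := by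
      have e : p = G u - (G u - z) - (z - p) := by ring
      calc ‖p‖ = ‖G u - (G u - z) - (z - p)‖ := by rw [← e]
        _ ≤ ‖G u‖ + ‖G u - z‖ + ‖z - p‖ :=
          (norm_sub_le _ _).trans (add_le_add_left (norm_sub_le _ _) _)
        _ ≤ _ := by rw [hD]; linarith
    have e2 : ‖u‖ ^ (2 * j) * ‖u‖ ^ 2 = (‖u‖ ^ (j + 1)) ^ 2 := by ring
    rw [e2]
    have h6 : 0 ≤ ‖p‖ := norm_nonneg _
    nlinarith [sq_nonneg (‖G u‖ - D * ‖u‖ ^ (j + 1)), pow_le_pow_left₀ h6 h5 2]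
  set σ := (volume : Measure (Rd d)).toSphere with hσ
  have hcont : Continuous fun θ : Metric.sphere (0 : Rd d) 1 =>
      ‖MvPolynomial.eval (fun i => (θ.1 i : ℂ)) P‖ₑ ^ 2 := by
    have := (continuous_eval_ofReal P).comp
      (continuous_subtype_val : Continuous (Subtype.val : Metric.sphere (0 : Rd d) 1 → Rd d))
    fun_prop
  set κ := ∫⁻ θ, ‖MvPolynomial.eval (fun i => (θ.1 i : ℂ)) P‖ₑ ^ 2 ∂σ with hκ
  have hκ0 : κ ≠ 0 := by
    obtain ⟨θ, hθ⟩ := exists_sphere_eval_ne_zero hd hPh hP0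
    refine ne_of_gt ?_
    rw [hκ, lintegral_pos_iff_support hcont.measurable]
    exact hcont.isOpen_support.measure_pos _ ⟨θ, by simpa using hθ⟩
  have hκt : κ ≠ ∞ := by
    obtain ⟨B, hB, hPB⟩ := exists_norm_eval_le P 0 (fun _ _ => Nat.zero_le _)
    have : κ ≤ ∫⁻ θ, ENNReal.ofReal B ^ 2 ∂σ := lintegral_mono fun θ => by
      gcongr
      rw [← ofReal_norm]
      exact ENNReal.ofReal_le_ofReal (by simpa using hPB θ.1 (by simp))
    refine ne_top_of_le_ne_top ?_ this
    rw [lintegral_const]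
    exact ENNReal.mul_ne_top (by simp) (measure_ne_top _ _)
  -- On spheres of radius `r < ε` the error term contributes at most `r^(2j) κ / 2`, half of the
  -- main term, and can be absorbed.
  obtain ⟨ε, hε, hεδ, hε1, hεκ⟩ : ∃ ε : ℝ, 0 < ε ∧ ε ≤ δ ∧ ε ≤ 1 ∧
      ENNReal.ofReal (2 * D ^ 2 * ε ^ 2) * σ Set.univ ≤ κ / 2 := by
    have hl : Tendsto (fun ε : ℝ => ENNReal.ofReal (2 * D ^ 2 * ε ^ 2) * σ Set.univ) (𝓝 0) (𝓝 0) := by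
      have h1 : Continuous fun ε : ℝ => ENNReal.ofReal (2 * D ^ 2 * ε ^ 2) :=
        ENNReal.continuous_ofReal.comp (by fun_prop)
      have h2 := ENNReal.Tendsto.mul_const (h1.tendsto 0) (Or.inr (measure_ne_top σ Set.univ))
      simpa using h2
    have hk : (0 : ℝ≥0∞) < κ / 2 := ENNReal.half_pos hκ0
    obtain ⟨η, hη, hηs⟩ := Metric.eventually_nhds_iff.1 (hl.eventually (gt_mem_nhds hk))
    refine ⟨min (η / 2) (min δ 1), by positivity, by simp, by simp, (hηs ?_).le⟩
    rw [Real.dist_0_eq_abs, abs_of_pos (by positivity)]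
    exact (min_le_left _ _).trans_lt (by linarith)
  have key := setLIntegral_radial_mul_le volume hw
    (p := fun u => 2 * ‖G u‖ₑ ^ 2)
    (q := fun r => ENNReal.ofReal (r ^ (2 * j)) * (κ / 2)) (ε := ε)
    (by fun_prop) (by fun_prop)
    (fun r hr _ => mul_ne_zero (by simpa using pow_pos hr _) (ENNReal.half_pos hκ0).ne')
    (fun r _ _ => ENNReal.mul_ne_top ENNReal.ofReal_ne_top (by finiteness))
    (fun r hr hrε => by
      have hpt : ∀ θ : Metric.sphere (0 : Rd d) 1,
          ENNReal.ofReal (r ^ (2 * j)) * ‖MvPolynomial.eval (fun i => (θ.1 i : ℂ)) P‖ₑ ^ 2 ≤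
          2 * ‖G (r • θ.1)‖ₑ ^ 2 +
            ENNReal.ofReal (r ^ (2 * j)) * ENNReal.ofReal (2 * D ^ 2 * ε ^ 2) := by
        intro θ
        have hn : ‖r • θ.1‖ = r := by simp [norm_smul, abs_of_pos hr]
        have hb := hbound (r • θ.1) (by rw [hn]; linarith) (by rw [hn]; linarith)
        rw [eval_smul_of_isHomogeneous hPh, hn, norm_mul, norm_pow, Complex.norm_real,
          Real.norm_of_nonneg hr.le] at hb
        have hb2 : r ^ (2 * j) * ‖MvPolynomial.eval (fun i => (θ.1 i : ℂ)) P‖ ^ 2 ≤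
            2 * ‖G (r • θ.1)‖ ^ 2 + r ^ (2 * j) * (2 * D ^ 2 * ε ^ 2) := by
          have : r ^ 2 ≤ ε ^ 2 := pow_le_pow_left₀ hr.le hrε.le 2
          have h7 : 2 * D ^ 2 * (r ^ (2 * j) * r ^ 2) ≤ r ^ (2 * j) * (2 * D ^ 2 * ε ^ 2) := by
            have : 0 ≤ 2 * D ^ 2 * r ^ (2 * j) := by positivity
            nlinarith
          calc _ = (r ^ j * ‖MvPolynomial.eval (fun i => (θ.1 i : ℂ)) P‖) ^ 2 := by ring
            _ ≤ _ := by linarith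
        have hb3 := ENNReal.ofReal_le_ofReal hb2
        rw [ENNReal.ofReal_add (by positivity) (by positivity), ENNReal.ofReal_mul (by positivity),
          ENNReal.ofReal_mul (by positivity), ENNReal.ofReal_mul (p := r ^ (2 * j)) (by positivity),
          ENNReal.ofReal_pow (norm_nonneg _), ENNReal.ofReal_pow (norm_nonneg _),
          ofReal_norm, ofReal_norm] at hb3
        simpa using hb3
      have hint := lintegral_mono (μ := σ) hpt
      rw [lintegral_const_mul _ hcont.measurable, lintegral_add_right _ measurable_const,
        lintegral_const, ← hκ, mul_assoc] at hint
      have h8 : ENNReal.ofReal (r ^ (2 * j)) * κ ≤ (∫⁻ θ, 2 * ‖G (r • θ.1)‖ₑ ^ 2 ∂σ) +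
          ENNReal.ofReal (r ^ (2 * j)) * (κ / 2) := hint.trans (by gcongr)
      rw [← ENNReal.add_halves κ, mul_add] at h8
      rw [ENNReal.add_halves] at h8
      exact (ENNReal.add_le_add_iff_right
        (ENNReal.mul_ne_top ENNReal.ofReal_ne_top (by finiteness))).1 h8)
  have hk2 : κ / 2 ≠ ∞ := by finiteness
  simp only [← mul_assoc] at key
  rw [lintegral_mul_const' _ _ hk2] at key
  -- Inside the unit ball a smaller exponent only enlarges the integrand, so divergence at `N` gives
  -- divergence at `j ≤ N`.
  have htop : ∫⁻ u in Metric.ball (0 : Rd d) ε, w u * ENNReal.ofReal (‖u‖ ^ (2 * j)) = ∞ := by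
    refine top_unique (hwN ε hε ▸ setLIntegral_mono' measurableSet_ball fun u hu => ?_)
    refine mul_le_mul_right (ENNReal.ofReal_le_ofReal ?_) _
    exact pow_le_pow_of_le_one (norm_nonneg _)
      ((mem_ball_zero_iff.1 hu).le.trans hε1) (by omega)
  rw [htop, ENNReal.top_mul (ENNReal.half_pos hκ0).ne', top_le_iff] at key
  have hlt : ∫⁻ u in Metric.ball (0 : Rd d) ε, w u * 2 * ‖G u‖ₑ ^ 2 < ∞ := by
    have e : ∀ u, w u * 2 * ‖G u‖ₑ ^ 2 = 2 * (w u * ‖G u‖ₑ ^ 2) := fun u => by ring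
    simp only [e]
    rw [lintegral_const_mul' _ _ (by simp)]
    refine ENNReal.mul_lt_top (by simp) (lt_of_le_of_lt ?_ hfin)
    exact lintegral_mono_set (Metric.ball_subset_ball hεδ)
  exact (ENNReal.mul_lt_top (measure_lt_top σ _) hlt).ne key

/-- Since `s ≤ s̃`, integrability against `1/s` implies integrability against the radial weight
`1/s̃`; the growth principle then applies with `G = Q` and no error. -/
theorem hasPoleOfOrder_inv (hd : 0 < d) (s : Rd d → ℝ≥0∞) {N : ℕ}
    (hN : ∀ ε : ℝ, 0 < ε → ∫⁻ u in Metric.ball (0 : Rd d) ε,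
      (radialSup s u)⁻¹ * ENNReal.ofReal (‖u‖ ^ (2 * N)) = ∞)
    {m : Fin d →₀ ℕ} (hm : multiLength m ≤ N) : HasPoleOfOrder (fun u => (s u)⁻¹) m := by
  rintro Q ⟨ε, hε, hQ⟩
  have h := homogeneousComponent_eq_zero_of_lintegral_lt_top hd
    (fun u v huv => congrArg (·⁻¹) (radialSup_radial s u v huv)) hN
    (continuous_eval_ofReal Q).measurable Q (C := 0) hε (by simp)
    (lt_of_le_of_lt (lintegral_mono fun u => ?_) hQ) hm
  · have := congrArg (MvPolynomial.coeff m) h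
    rwa [MvPolynomial.coeff_homogeneousComponent, if_pos (multiLength_eq_degree m).symm] at this
  · rw [mul_comm]
    exact mul_le_mul_right (ENNReal.inv_le_inv.2 (le_radialSup s rfl)) _

end Poles

/-! ### Trigonometric polynomials and duality in weighted `L²`. -/

section Duality

variable {d : ℕ}

/-- The plane wave `u ↦ exp(-i⟨u,x⟩)`. -/
noncomputable def wave {d : ℕ} (x u : Rd d) : ℂ :=
  Complex.exp (-(Complex.I * ((inner ℝ u x : ℝ) : ℂ)))

/-- The trigonometric polynomial `∑ c_x exp(-i⟨u,x⟩)`. -/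
noncomputable def trig {d : ℕ} (c : Rd d →₀ ℂ) (u : Rd d) : ℂ := c.sum fun x a => a * wave x u

theorem continuous_wave (x : Rd d) : Continuous (wave x) := by
  unfold wave; fun_prop

theorem norm_wave (x u : Rd d) : ‖wave x u‖ = 1 := by
  unfold wave
  rw [show -(Complex.I * ((inner ℝ u x : ℝ) : ℂ)) = ((-inner ℝ u x : ℝ) : ℂ) * Complex.I by
    push_cast; ring]
  exact Complex.norm_exp_ofReal_mul_I _

theorem conj_wave (x u : Rd d) : (starRingEnd ℂ) (wave x u) = wave (-x) u := by
  unfold wave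
  rw [← Complex.exp_conj]
  simp

theorem wave_neg_right (x u : Rd d) : wave x (-u) = wave (-x) u := by
  unfold wave; simp

theorem continuous_trig (c : Rd d →₀ ℂ) : Continuous (trig c) := by
  unfold trig Finsupp.sum
  exact continuous_finsetSum _ fun x _ => continuous_const.mul (continuous_wave x)

theorem memLp_wave (μ : Measure (Rd d)) [IsFiniteMeasure μ] (p : ℝ≥0∞) (x : Rd d) :
    MemLp (wave x) p μ :=
  MemLp.of_bound (continuous_wave x).aestronglyMeasurable 1 (ae_of_all _ fun u => (norm_wave x u).le)

theorem memLp_trig (μ : Measure (Rd d)) [IsFiniteMeasure μ] (p : ℝ≥0∞) (c : Rd d →₀ ℂ) :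
    MemLp (trig c) p μ := by
  unfold trig Finsupp.sum
  exact memLp_finsetSum _ fun x _ => (memLp_wave μ p x).const_mul _

theorem integrable_wave_mul {μ : Measure (Rd d)} (x : Rd d) {h : Rd d → ℂ} (hh : Integrable h μ) :
    Integrable (fun u => wave x u * h u) μ :=
  hh.bdd_mul (continuous_wave x).aestronglyMeasurable (ae_of_all _ fun u => (norm_wave x u).le)

/-- The positive and negative parts of `a` are densities of two finite measures with the same
characteristic function, hence equal. -/
theorem ae_eq_zero_of_integral_wave_real {μ : Measure (Rd d)} [IsFiniteMeasure μ] {a : Rd d → ℝ}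
    (ha : Integrable a μ) (h : ∀ x, ∫ u, wave x u * (a u : ℂ) ∂μ = 0) : a =ᵐ[μ] 0 := by
  have hm : AEMeasurable (fun u => ENNReal.ofReal (a u)) μ := ha.aemeasurable.ennreal_ofReal
  have hm' : AEMeasurable (fun u => ENNReal.ofReal (-a u)) μ := ha.aemeasurable.neg.ennreal_ofReal
  have hf := ha.lintegral_lt_top
  have hf' : ∫⁻ u, ENNReal.ofReal (-a u) ∂μ < ∞ := ha.neg.lintegral_lt_top
  have := isFiniteMeasure_withDensity hf.ne
  have := isFiniteMeasure_withDensity hf'.ne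
  have key : μ.withDensity (fun u => ENNReal.ofReal (a u)) =
      μ.withDensity (fun u => ENNReal.ofReal (-a u)) := by
    refine Measure.ext_of_charFun (funext fun t => ?_)
    have hw : ∀ u : Rd d, Complex.exp ((inner ℝ u t : ℝ) * Complex.I) = wave (-t) u := fun u => by
      unfold wave; congr 1; simp; ring
    simp only [charFun_apply, hw]
    rw [integral_withDensity_eq_integral_toReal_smul₀ hm (by simp),
      integral_withDensity_eq_integral_toReal_smul₀ hm' (by simp), ← sub_eq_zero, ← integral_sub]
    · rw [← h (-t)]
      refine integral_congr_ae (ae_of_all _ fun u => ?_)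
      rcases le_total 0 (a u) with h0 | h0
      · simp [ENNReal.toReal_ofReal h0, ENNReal.ofReal_of_nonpos (neg_nonpos.2 h0), mul_comm]
      · simp [ENNReal.toReal_ofReal (neg_nonneg.2 h0), ENNReal.ofReal_of_nonpos h0, mul_comm]
    · have := integrable_wave_mul (-t) (ha.pos_part.ofReal (𝕜 := ℂ))
      refine this.congr (ae_of_all _ fun u => ?_)
      simp [ENNReal.toReal_ofReal', mul_comm]
    · have := integrable_wave_mul (-t) (ha.neg_part.ofReal (𝕜 := ℂ))
      refine this.congr (ae_of_all _ fun u => ?_)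
      simp [ENNReal.toReal_ofReal', mul_comm]
  have h1 := (withDensity_eq_iff hm hm' hf.ne).1 key
  filter_upwards [h1] with u hu
  rcases lt_trichotomy (a u) 0 with h0 | h0 | h0
  · rw [ENNReal.ofReal_of_nonpos h0.le] at hu
    have := ENNReal.ofReal_eq_zero.1 hu.symm
    simp only [Pi.zero_apply]; linarith
  · exact h0
  · rw [ENNReal.ofReal_of_nonpos (by linarith : -a u ≤ 0)] at hu
    have := ENNReal.ofReal_eq_zero.1 hu
    simp only [Pi.zero_apply]; linarith

/-- An integrable function orthogonal to all plane waves vanishes. -/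
theorem ae_eq_zero_of_integral_wave {μ : Measure (Rd d)} [IsFiniteMeasure μ] {h : Rd d → ℂ}
    (hh : Integrable h μ) (h0 : ∀ x, ∫ u, wave x u * h u ∂μ = 0) : h =ᵐ[μ] 0 := by
  -- The plane waves are stable under conjugation, so the conjugate of `h` is orthogonal to them as
  -- well; this reduces the claim to real and imaginary parts.
  have hc : ∀ x, ∫ u, wave x u * (starRingEnd ℂ) (h u) ∂μ = 0 := fun x => by
    have := congrArg (starRingEnd ℂ) (h0 (-x))
    rw [← integral_conj, map_zero] at this
    rw [← this]
    refine integral_congr_ae (ae_of_all _ fun u => ?_)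
    simp [conj_wave]
  have hci : Integrable (fun u => (starRingEnd ℂ) (h u)) μ :=
    (Complex.conjCLE.toContinuousLinearMap).integrable_comp hh
  have hre : (fun u => (h u).re) =ᵐ[μ] 0 := by
    refine ae_eq_zero_of_integral_wave_real hh.re fun x => ?_
    have e : ∀ u, wave x u * ((h u).re : ℂ) =
        (1 / 2) * (wave x u * h u + wave x u * (starRingEnd ℂ) (h u)) := fun u => by
      rw [← mul_add, Complex.add_conj]; push_cast; ring
    simp only [e]
    rw [integral_const_mul, integral_add (integrable_wave_mul x hh) (integrable_wave_mul x hci), h0,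
      hc]
    simp
  have him : (fun u => (h u).im) =ᵐ[μ] 0 := by
    refine ae_eq_zero_of_integral_wave_real hh.im fun x => ?_
    have e : ∀ u, wave x u * ((h u).im : ℂ) =
        (-Complex.I / 2) * (wave x u * h u - wave x u * (starRingEnd ℂ) (h u)) := fun u => by
      rw [← mul_sub, Complex.sub_conj]
      push_cast
      linear_combination (wave x u * ((h u).im : ℂ)) * Complex.I_mul_I
    simp only [e]
    rw [integral_const_mul, integral_sub (integrable_wave_mul x hh) (integrable_wave_mul x hci), h0,
      hc]
    simp
  filter_upwards [hre, him] with u h1 h2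
  exact Complex.ext h1 h2

/-- Trigonometric polynomials are dense in `L²` of a finite measure. -/
theorem exists_trig_eLpNorm_sub_tendsto (μ : Measure (Rd d)) [IsFiniteMeasure μ] {g : Rd d → ℂ}
    (hg : MemLp g 2 μ) :
    ∃ c : ℕ → Rd d →₀ ℂ, Tendsto (fun n => eLpNorm (trig (c n) - g) 2 μ) atTop (𝓝 0) := by
  let W : Rd d → Lp ℂ 2 μ := fun x => (memLp_wave μ 2 x).toLp
  let K : Submodule ℂ (Lp ℂ 2 μ) := Submodule.span ℂ (Set.range W)
  have hK : K.topologicalClosure = ⊤ := by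
    rw [Submodule.topologicalClosure_eq_top_iff, Submodule.eq_bot_iff]
    intro f hf
    have hfi : Integrable f μ := (Lp.memLp f).integrable (by norm_num)
    rw [Lp.eq_zero_iff_ae_eq_zero]
    refine ae_eq_zero_of_integral_wave hfi fun x => ?_
    have h1 := (Submodule.mem_orthogonal _ _).1 hf (W (-x)) (Submodule.subset_span ⟨_, rfl⟩)
    rw [L2.inner_def] at h1
    rw [← h1]
    refine integral_congr_ae ?_
    filter_upwards [(memLp_wave μ 2 (-x)).coeFn_toLp] with u hu
    simp only [W, hu, RCLike.inner_apply, conj_wave, neg_neg]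
    ring
  have hmem : hg.toLp ∈ closure (K : Set (Lp ℂ 2 μ)) := by
    rw [← Submodule.topologicalClosure_coe, hK]; trivial
  obtain ⟨k, hk, hlim⟩ := mem_closure_iff_seq_limit.1 hmem
  have hc : ∀ n, ∃ c : Rd d →₀ ℂ, (k n : Rd d → ℂ) =ᵐ[μ] trig c := fun n => by
    obtain ⟨c, hc⟩ := Finsupp.mem_span_range_iff_exists_finsupp.1 (hk n)
    refine ⟨c, ?_⟩
    have h2 : (memLp_trig μ 2 c).toLp = k n := by
      rw [← hc]
      unfold trig Finsupp.sum
      have : ∀ s : Finset (Rd d), ∀ hs : MemLp (fun u => ∑ x ∈ s, c x * wave x u) 2 μ,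
          hs.toLp = ∑ x ∈ s, c x • W x := by
        intro s hs
        apply Lp.ext
        refine hs.coeFn_toLp.trans ?_
        refine EventuallyEq.symm ((Lp.coeFn_finsetSum s _).trans ?_)
        have h3 : ∀ᵐ u ∂μ, ∀ x ∈ s, (c x • W x : Lp ℂ 2 μ) u = c x * wave x u := by
          rw [Finset.eventually_all]
          intro x _
          filter_upwards [Lp.coeFn_smul (c x) (W x), (memLp_wave μ 2 x).coeFn_toLp] with u h4 h5
          rw [h4, Pi.smul_apply, h5, smul_eq_mul]
        filter_upwards [h3] with u hu
        simp only [Finset.sum_apply]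
        exact Finset.sum_congr rfl hu
      exact this _ _
    rw [← h2]
    exact MemLp.coeFn_toLp _
  choose c hc using hc
  refine ⟨c, ?_⟩
  have h6 := (tendsto_iff_edist_tendsto_0.1 hlim)
  refine h6.congr fun n => ?_
  rw [Lp.edist_def]
  exact eLpNorm_congr_ae ((hc n).sub hg.coeFn_toLp)

/-- A bound on trigonometric polynomials extends to all bounded functions. -/
theorem enorm_integral_mul_le_of_trig {T : Measure (Rd d)} [IsFiniteMeasure T] {F : Rd d → ℂ}
    (hF : Integrable F) {A : ℝ≥0∞} (hA : A ≠ ∞)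
    (h : ∀ c, ‖∫ u, trig c u * F u‖ₑ ≤ A * eLpNorm (trig c) 2 T) {φ : Rd d → ℂ}
    (hφ : Measurable φ) {B : ℝ} (hB : ∀ u, ‖φ u‖ ≤ B) :
    ‖∫ u, φ u * F u‖ₑ ≤ A * eLpNorm φ 2 T := by
  -- Approximating `φ` in `L²(T + ρ)` gives convergence in `L²(T)` and, as `ρ` is finite, in
  -- `L¹(ρ)`, so both sides of the bound pass to the limit along one sequence.
  set ρ : Measure (Rd d) := volume.withDensity fun u => ‖F u‖ₑ with hρ
  have : IsFiniteMeasure ρ := isFiniteMeasure_withDensity hF.hasFiniteIntegral.ne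
  have hφL : MemLp φ 2 (T + ρ) := MemLp.of_bound hφ.aestronglyMeasurable B (ae_of_all _ hB)
  obtain ⟨c, hc⟩ := exists_trig_eLpNorm_sub_tendsto (T + ρ) hφL
  have hcT : Tendsto (fun n => eLpNorm (trig (c n) - φ) 2 T) atTop (𝓝 0) :=
    tendsto_of_tendsto_of_tendsto_of_le_of_le tendsto_const_nhds hc (fun _ => zero_le)
      fun n => eLpNorm_mono_measure _ (Measure.le_add_right le_rfl)
  have hcρ : Tendsto (fun n => eLpNorm (trig (c n) - φ) 2 ρ) atTop (𝓝 0) :=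
    tendsto_of_tendsto_of_tendsto_of_le_of_le tendsto_const_nhds hc (fun _ => zero_le)
      fun n => eLpNorm_mono_measure _ (Measure.le_add_left le_rfl)
  set κ : ℝ≥0∞ := ρ Set.univ ^ (1 / (1 : ℝ≥0∞).toReal - 1 / (2 : ℝ≥0∞).toReal) with hκ
  have hκt : κ ≠ ∞ := ENNReal.rpow_ne_top_of_nonneg (by norm_num) (measure_ne_top _ _)
  have hφF : Integrable fun u => φ u * F u := hF.bdd_mul hφ.aestronglyMeasurable (ae_of_all _ hB)
  have hdiff : ∀ n, ‖(∫ u, φ u * F u) - ∫ u, trig (c n) u * F u‖ₑ ≤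
      κ * eLpNorm (trig (c n) - φ) 2 ρ := by
    intro n
    have hti : Integrable fun u => trig (c n) u * F u := by
      refine hF.bdd_mul (c := ∑ x ∈ (c n).support, ‖c n x‖)
        (continuous_trig _).aestronglyMeasurable (ae_of_all _ fun u => ?_)
      refine norm_sum_le_of_le _ fun x _ => ?_
      rw [norm_mul, norm_wave, mul_one]
    rw [← integral_sub hφF hti, mul_comm]
    refine (enorm_integral_le_lintegral_enorm _).trans ?_
    have e : ∫⁻ u, ‖φ u * F u - trig (c n) u * F u‖ₑ = eLpNorm (trig (c n) - φ) 1 ρ := by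
      rw [eLpNorm_one_eq_lintegral_enorm, hρ,
        lintegral_withDensity_eq_lintegral_mul₀ hF.aestronglyMeasurable.enorm
          ((continuous_trig _).measurable.sub hφ).enorm.aemeasurable]
      refine lintegral_congr fun u => ?_
      rw [← sub_mul, enorm_mul, enorm_sub_rev, mul_comm]
      rfl
    rw [e]
    exact eLpNorm_le_eLpNorm_mul_rpow_measure_univ (by norm_num)
      ((continuous_trig _).measurable.sub hφ).aestronglyMeasurable
  have hlim : Tendsto (fun n => κ * eLpNorm (trig (c n) - φ) 2 ρ +
      A * (eLpNorm φ 2 T + eLpNorm (trig (c n) - φ) 2 T)) atTop (𝓝 (A * eLpNorm φ 2 T)) := by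
    have h1 := ENNReal.Tendsto.const_mul hcρ (Or.inr hκt)
    have h2 := ENNReal.Tendsto.const_mul (tendsto_const_nhds (x := eLpNorm φ 2 T) |>.add hcT)
      (Or.inr hA)
    simpa using h1.add h2
  refine ge_of_tendsto' hlim fun n => ?_
  have e : (∫ u, φ u * F u) = ((∫ u, φ u * F u) - ∫ u, trig (c n) u * F u) +
      ∫ u, trig (c n) u * F u := by ring
  rw [e]
  refine (enorm_add_le _ _).trans (add_le_add (hdiff n) ((h _).trans (mul_le_mul_right ?_ _)))
  have e2 : trig (c n) = φ + (trig (c n) - φ) := by ring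
  conv_lhs => rw [e2]
  exact eLpNorm_add_le hφ.aestronglyMeasurable
    ((continuous_trig _).measurable.sub hφ).aestronglyMeasurable (by norm_num)

/-- If integration against `F` is bounded on trigonometric polynomials for the `L²` norm of `T`,
then `|F|² / q` is integrable, where `q` is the density of `T`. -/
theorem lintegral_enorm_sq_mul_inv_le {T τ : Measure (Rd d)} [IsFiniteMeasure T] {q : Rd d → ℝ≥0∞}
    (hq : Measurable q) (hτ : τ ⟂ₘ (volume : Measure (Rd d)))
    (hT : T = τ + (volume : Measure (Rd d)).withDensity q)
    {F : Rd d → ℂ} (hF : Integrable F) (hFm : Measurable F) {B : ℝ} (hB : ∀ u, ‖F u‖ ≤ B)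
    {A : ℝ≥0∞} (hA : A ≠ ∞) (h : ∀ c, ‖∫ u, trig c u * F u‖ₑ ≤ A * eLpNorm (trig c) 2 T) :
    ∫⁻ u, ‖F u‖ₑ ^ 2 * (q u)⁻¹ ≤ A ^ 2 := by
  obtain ⟨N, hN, hτN, hvN⟩ := hτ
  -- Adding `δ n` keeps the inverse density bounded where `q` vanishes; it is removed at the end by
  -- Fatou's lemma.
  set δ : ℕ → ℝ≥0∞ := fun n => ((n : ℝ≥0∞) + 1)⁻¹ with hδ
  have hδ0 : ∀ n, δ n ≠ 0 := fun n => by simp [hδ]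
  have hδi : ∀ n u, (q u + δ n)⁻¹ ≤ (n : ℝ≥0∞) + 1 := fun n u => by
    rw [ENNReal.inv_le_iff_inv_le]; exact le_add_self
  set J : ℕ → ℝ≥0∞ := fun n => ∫⁻ u, ‖F u‖ₑ ^ 2 * (q u + δ n)⁻¹ with hJ
  have hJA : ∀ n, J n ≤ A ^ 2 := by
    intro n
    set r : Rd d → ℝ := fun u => ((q u + δ n)⁻¹).toReal with hr
    have hrt : ∀ u, (q u + δ n)⁻¹ ≠ ∞ := fun u => by simp [hδ0]
    have hrm : Measurable r := by
      rw [hr]; fun_prop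
    have hrb : ∀ u, r u ≤ n + 1 := fun u => by
      have := ENNReal.toReal_mono (by finiteness) (hδi n u)
      rwa [ENNReal.toReal_add (by simp) (by simp), ENNReal.toReal_natCast,
        ENNReal.toReal_one] at this
    have hr0 : ∀ u, 0 ≤ r u := fun u => ENNReal.toReal_nonneg
    have hB0 : 0 ≤ B := (norm_nonneg _).trans (hB 0)
    -- The extremal choice: `N` is null for `τ` and conull for Lebesgue measure, so the singular
    -- part disappears. Then `∫ φ F = J n` while the squared norm of `φ` in `L²(T)` is at most `J
    -- n`, whence `(J n)² ≤ A² J n`; `J n` is finite and cancels.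
    set φ : Rd d → ℂ := N.indicator fun u => (r u : ℂ) * (starRingEnd ℂ) (F u) with hφ
    have hφm : Measurable φ := by
      refine Measurable.indicator ?_ hN
      exact (Complex.measurable_ofReal.comp hrm).mul (Complex.continuous_conj.measurable.comp hFm)
    have hφb : ∀ u, ‖φ u‖ ≤ (n + 1) * B := by
      intro u
      refine (norm_indicator_le_norm_self _ _).trans ?_
      rw [norm_mul, Complex.norm_real, Real.norm_of_nonneg (hr0 u), RCLike.norm_conj]
      exact mul_le_mul (hrb u) (hB u) (norm_nonneg _) (by positivity)
    have key := enorm_integral_mul_le_of_trig hF hA h hφm hφb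
    have hpt : ∀ u, ENNReal.ofReal (r u * ‖F u‖ ^ 2) = ‖F u‖ₑ ^ 2 * (q u + δ n)⁻¹ := fun u => by
      rw [mul_comm, ENNReal.ofReal_mul (by positivity), ENNReal.ofReal_toReal (hrt u),
        ENNReal.ofReal_pow (norm_nonneg _), ofReal_norm]
    have hint : Integrable fun u => r u * ‖F u‖ ^ 2 := by
      have h1 : Integrable fun u => (r u * ‖F u‖) * ‖F u‖ := by
        refine hF.norm.bdd_mul (c := (n + 1) * B) ?_ (ae_of_all _ fun u => ?_)
        · exact (hrm.mul hFm.norm).aestronglyMeasurable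
        · rw [Real.norm_of_nonneg (mul_nonneg (hr0 u) (norm_nonneg _))]
          exact mul_le_mul (hrb u) (hB u) (norm_nonneg _) (by positivity)
      exact h1.congr (ae_of_all _ fun u => by ring)
    have hNae : ∀ᵐ u : Rd d, u ∈ N := by
      rw [ae_iff]; exact hvN
    have hL : ∫ u, φ u * F u = ((∫ u, r u * ‖F u‖ ^ 2 : ℝ) : ℂ) := by
      rw [← integral_complex_ofReal]
      refine integral_congr_ae ?_
      filter_upwards [hNae] with u hu
      rw [hφ, Set.indicator_of_mem hu, mul_assoc, Complex.conj_mul']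
      push_cast; ring
    have hLJ : ‖∫ u, φ u * F u‖ₑ = J n := by
      rw [hL, ← ofReal_norm, Complex.norm_real, Real.norm_of_nonneg
        (integral_nonneg fun u => mul_nonneg (hr0 u) (by positivity)),
        ofReal_integral_eq_lintegral_ofReal hint
          (ae_of_all _ fun u => mul_nonneg (hr0 u) (by positivity))]
      exact lintegral_congr hpt
    have hJt : J n ≠ ∞ := by
      rw [← hLJ]; exact enorm_ne_top
    have hR : eLpNorm φ 2 T ^ 2 ≤ J n := by
      have e1 : eLpNorm φ 2 T ^ 2 = ∫⁻ u, ‖φ u‖ₑ ^ 2 ∂T := by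
        have := eLpNorm_nnreal_pow_eq_lintegral (f := φ) (μ := T) (p := 2) (by norm_num)
        simpa using this
      have hφ2 : Measurable fun u => ‖φ u‖ₑ ^ 2 := by fun_prop
      rw [e1, hT, lintegral_add_measure]
      have e2 : ∫⁻ u, ‖φ u‖ₑ ^ 2 ∂τ = 0 := by
        rw [lintegral_eq_zero_iff hφ2]
        have : ∀ᵐ u ∂τ, u ∉ N := by rw [ae_iff]; simpa using hτN
        filter_upwards [this] with u hu
        simp [hφ, Set.indicator_of_notMem hu]
      rw [e2, zero_add, lintegral_withDensity_eq_lintegral_mul _ hq hφ2]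
      refine lintegral_mono fun u => ?_
      have e3 : ‖φ u‖ₑ ≤ (q u + δ n)⁻¹ * ‖F u‖ₑ := by
        rw [← ofReal_norm]
        refine (ENNReal.ofReal_le_ofReal (norm_indicator_le_norm_self _ _)).trans ?_
        rw [norm_mul, Complex.norm_real, Real.norm_of_nonneg (hr0 u), RCLike.norm_conj,
          ENNReal.ofReal_mul (hr0 u), ENNReal.ofReal_toReal (hrt u), ofReal_norm]
      calc q u * ‖φ u‖ₑ ^ 2 ≤ (q u + δ n) * ((q u + δ n)⁻¹ * ‖F u‖ₑ) ^ 2 := by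
            gcongr; exact le_self_add
        _ = ((q u + δ n) * (q u + δ n)⁻¹) * (‖F u‖ₑ ^ 2 * (q u + δ n)⁻¹) := by ring
        _ ≤ 1 * (‖F u‖ₑ ^ 2 * (q u + δ n)⁻¹) := by
            gcongr; exact ENNReal.mul_inv_le_one _
        _ = _ := one_mul _
    rw [hLJ] at key
    have h2 : J n * J n ≤ A ^ 2 * J n := by
      calc J n * J n = J n ^ 2 := (sq _).symm
        _ ≤ (A * eLpNorm φ 2 T) ^ 2 := by gcongr
        _ = A ^ 2 * eLpNorm φ 2 T ^ 2 := mul_pow _ _ _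
        _ ≤ _ := by gcongr
    by_cases hJ0 : J n = 0
    · rw [hJ0]; exact zero_le
    · exact (ENNReal.mul_le_mul_iff_left hJ0 hJt).1 h2
  have hδl : Tendsto δ atTop (𝓝 0) := by
    have h1 : Tendsto (fun n : ℕ => (((n + 1 : ℕ) : ℝ≥0∞))⁻¹) atTop (𝓝 0) :=
      ENNReal.tendsto_inv_nat_nhds_zero.comp (tendsto_add_atTop_nat 1)
    exact h1.congr fun n => by simp [hδ]
  have hpt : ∀ u, ‖F u‖ₑ ^ 2 * (q u)⁻¹ =
      liminf (fun n => ‖F u‖ₑ ^ 2 * (q u + δ n)⁻¹) atTop := fun u => by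
    refine (Tendsto.liminf_eq ?_).symm
    refine ENNReal.Tendsto.const_mul ?_ (Or.inr (by finiteness))
    refine tendsto_inv_iff.2 ?_
    simpa using (tendsto_const_nhds (x := q u)).add hδl
  simp only [hpt]
  refine (lintegral_liminf_le fun n => by fun_prop).trans ?_
  exact liminf_le_of_le (by isBoundedDefault) fun b hb => by
    obtain ⟨n, hn⟩ := hb.exists
    exact hn.trans (hJA n)

end Duality

/-! ### Fourier transforms of test functions and the choice of a window. -/

section FourierWindow

open scoped FourierTransform

variable {d : ℕ}

theorem IsTestFun.integrable {f : Rd d → ℝ} (hf : IsTestFun f) : Integrable f := by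
  obtain ⟨C, hC⟩ := hf.bounded
  rw [← integrableOn_iff_integrable_of_support_subset (subset_tsupport f)]
  refine Measure.integrableOn_of_bounded (M := C) ?_ hf.measurable.aestronglyMeasurable
    (ae_of_all _ hC)
  exact (IsCompact.measure_lt_top hf.compactSupport).ne

theorem fourierHat_eq_wave (f : Rd d → ℝ) (u : Rd d) :
    fourierHat f u = ∫ t, wave t u * (f t : ℂ) := rfl

theorem fourierHat_eq_fourier (f : Rd d → ℝ) (u : Rd d) :
    fourierHat f u = 𝓕 (fun t => (f t : ℂ)) ((2 * Real.pi)⁻¹ • u) := by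
  rw [Real.fourier_eq']
  refine integral_congr_ae (ae_of_all _ fun t => ?_)
  simp only [smul_eq_mul]
  congr 2
  rw [inner_smul_right, real_inner_comm]
  have : (Real.pi : ℂ) ≠ 0 := by exact_mod_cast Real.pi_ne_zero
  push_cast
  field_simp

theorem fourierHat_translate (f : Rd d → ℝ) (x u : Rd d) :
    fourierHat (fun t => f (t - x)) u = wave x u * fourierHat f u := by
  rw [fourierHat_eq_wave, fourierHat_eq_wave,
    ← integral_add_right_eq_self (fun t => wave t u * ((f (t - x) : ℝ) : ℂ)) x,
    ← integral_const_mul]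
  refine integral_congr_ae (ae_of_all _ fun t => ?_)
  simp only [add_sub_cancel_right, ← mul_assoc]
  congr 1
  unfold wave
  rw [← Complex.exp_add]
  congr 1
  rw [inner_add_right]
  push_cast; ring

theorem norm_fourierHat_neg (f : Rd d → ℝ) (u : Rd d) : ‖fourierHat f (-u)‖ = ‖fourierHat f u‖ := by
  rw [← RCLike.norm_conj (fourierHat f u), fourierHat_eq_wave, fourierHat_eq_wave, ← integral_conj]
  congr 1
  refine integral_congr_ae (ae_of_all _ fun t => ?_)
  simp [conj_wave, wave_neg_right]

theorem norm_fourierHat_le (f : Rd d → ℝ) (u : Rd d) : ‖fourierHat f u‖ ≤ ∫ t, ‖f t‖ := by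
  rw [fourierHat_eq_wave]
  refine (norm_integral_le_integral_norm _).trans (le_of_eq ?_)
  refine integral_congr_ae (ae_of_all _ fun t => ?_)
  simp [norm_wave]

theorem integrable_wave_mul_testFun {f : Rd d → ℝ} (hf : IsTestFun f) (u : Rd d) :
    Integrable fun t => wave t u * (f t : ℂ) := by
  have e : ∀ t, wave t u = wave u t := fun t => by unfold wave; rw [real_inner_comm]
  simp only [e]
  exact integrable_wave_mul u hf.integrable.ofReal

/-- There is a continuous test function with integrable Fourier transform, non-zero at `0`, to which
the inversion formula applies. -/
theorem exists_window : ∃ f : Rd d → ℝ, IsTestFun f ∧ Continuous f ∧ Integrable (fourierHat f) ∧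
    Continuous (fourierHat f) ∧ fourierHat f 0 ≠ 0 ∧
    ∀ t, (f t : ℂ) = ∫ u, (((2 * Real.pi) ^ d)⁻¹ : ℝ) • (fourierHat f u * wave (-t) u) := by
  -- A smooth bump is a Schwartz function, which gives integrability and inversion; its transform at
  -- `0` is its integral, which is positive.
  let b : ContDiffBump (0 : Rd d) := ⟨1, 2, one_pos, one_lt_two⟩
  have hbC : HasCompactSupport fun t => (b t : ℂ) := b.hasCompactSupport.comp_left Complex.ofReal_zero
  have hbS : ContDiff ℝ ((⊤ : ℕ∞) : WithTop ℕ∞) fun t => (b t : ℂ) :=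
    Complex.ofRealCLM.contDiff.comp b.contDiff
  let g := hbC.toSchwartzMap hbS
  have hg : (g : Rd d → ℂ) = fun t => (b t : ℂ) := rfl
  have h2π : (2 * Real.pi) ≠ 0 := by positivity
  have hF : fourierHat (fun t => b t) = fun u => 𝓕 g ((2 * Real.pi)⁻¹ • u) := by
    funext u
    rw [fourierHat_eq_fourier, SchwartzMap.fourier_coe, hg]
  have htest : IsTestFun fun t => b t :=
    ⟨b.continuous.measurable, ⟨1, fun t => by rw [abs_of_nonneg b.nonneg]; exact b.le_one⟩,
      b.hasCompactSupport⟩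
  have hint : Integrable (fourierHat fun t => b t) := by
    rw [hF]
    exact (𝓕 g).integrable.comp_smul (inv_ne_zero h2π)
  refine ⟨fun t => b t, htest, b.continuous, hint, ?_, ?_, fun t => ?_⟩
  · rw [hF]
    exact (𝓕 g).continuous.comp (by fun_prop)
  · have : fourierHat (fun t => b t) 0 = ((∫ t, b t : ℝ) : ℂ) := by
      rw [fourierHat_eq_wave, ← integral_complex_ofReal]
      simp [wave]
    rw [this]
    exact_mod_cast b.integral_pos.ne'
  · have h1 : 𝓕⁻ (𝓕 g) t = g t := by rw [FourierTransform.fourierInv_fourier_eq]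
    have h2 : g t = (b t : ℂ) := rfl
    rw [← h2, ← h1, SchwartzMap.fourierInv_coe, Real.fourierInv_eq']
    have h3 := Measure.integral_comp_smul (volume : Measure (Rd d))
      (fun u => fourierHat (fun t => b t) u * wave (-t) u) (2 * Real.pi)
    rw [integral_smul]
    rw [finrank_euclideanSpace_fin, abs_of_nonneg (by positivity)] at h3
    rw [← h3]
    refine integral_congr_ae (ae_of_all _ fun v => ?_)
    simp only [hF, smul_smul, inv_mul_cancel₀ h2π, one_smul, smul_eq_mul]
    rw [mul_comm]
    congr 1
    unfold wave
    rw [inner_smul_left, inner_neg_right]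
    congr 1
    simp
    ring

end FourierWindow

/-! ### Functionals on `C(K)`: Fourier representation and Taylor expansion. -/

section Functional

variable {d : ℕ} {K : Set (Rd d)}

/-- The function `t ↦ exp(i⟨u,t⟩)` on `K`. -/
noncomputable def planeWave (K : Set (Rd d)) (u : Rd d) : C(K, ℂ) where
  toFun t := wave (-t.1) u
  continuous_toFun := by unfold wave; fun_prop

theorem continuous_planeWave : Continuous (planeWave K) := by
  refine ContinuousMap.continuous_of_continuous_uncurry _ ?_
  change Continuous fun p : Rd d × K => wave (-p.2.1) p.1
  unfold wave; fun_prop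

/-- The restriction to `K` of a monomial. -/
noncomputable def monomialOn (K : Set (Rd d)) (m : Fin d →₀ ℕ) : C(K, ℂ) where
  toFun t := (monomialFun m t.1 : ℂ)
  continuous_toFun := Complex.continuous_ofReal.comp
    ((continuous_monomialFun m).comp continuous_subtype_val)

variable [CompactSpace K]

theorem norm_planeWave_le (u : Rd d) : ‖planeWave K u‖ ≤ 1 :=
  (ContinuousMap.norm_le _ zero_le_one).2 fun _ => norm_wave _ u |>.le

/-- Fourier inversion writes the translate as a Bochner integral of plane waves in `C(K)`, and `L`
commutes with that integral. -/
theorem apply_translate_eq_integral (L : C(K, ℂ) →L[ℂ] ℂ) {f : Rd d → ℝ}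
    (hint : Integrable (fourierHat f)) {c : ℝ}
    (hinv : ∀ t, (f t : ℂ) = ∫ u, c • (fourierHat f u * wave (-t) u)) (x : Rd d) (g : C(K, ℂ))
    (hg : ∀ t : K, g t = (f (t.1 - x) : ℂ)) :
    L g = ∫ u, wave x u * (c * fourierHat f u * L (planeWave K u)) := by
  have hi : Integrable fun u => (wave x u * (c * fourierHat f u)) • planeWave K u := by
    have h1 : Integrable fun u => wave x u * (c * fourierHat f u) :=
      integrable_wave_mul x (hint.const_mul _)
    exact h1.smul_bdd (C := 1) continuous_planeWave.aestronglyMeasurable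
      (ae_of_all _ norm_planeWave_le)
  have hgi : g = ∫ u, (wave x u * (c * fourierHat f u)) • planeWave K u := by
    ext t
    have h2 := (ContinuousMap.evalCLM ℂ t).integral_comp_comm hi
    simp only [ContinuousMap.evalCLM_apply] at h2
    rw [← h2, hg, hinv]
    refine integral_congr_ae (ae_of_all _ fun u => ?_)
    have hw : wave (-(t.1 - x)) u = wave x u * wave (-t.1) u := by
      unfold wave
      rw [← Complex.exp_add]
      congr 1
      rw [inner_neg_right, inner_sub_right, inner_neg_right]
      push_cast; ring
    simp only [ContinuousMap.smul_apply, smul_eq_mul, Complex.real_smul, hw, planeWave,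
      ContinuousMap.coe_mk]
    ring
  rw [hgi, ← L.integral_comp_comm hi]
  refine integral_congr_ae (ae_of_all _ fun u => ?_)
  simp only [map_smul, smul_eq_mul]
  ring

theorem monomial_eval_eq (m : Fin d →₀ ℕ) (a : ℂ) (u : Rd d) :
    MvPolynomial.eval (fun i => (u i : ℂ)) (MvPolynomial.monomial m a) = a * monomialFun m u := by
  rw [MvPolynomial.eval_monomial, Finsupp.prod_fintype _ _ (by simp)]
  simp [monomialFun]

/-- The Taylor expansion at `0` of `u ↦ L(exp(i⟨u,·⟩))`. -/
theorem exists_taylor (L : C(K, ℂ) →L[ℂ] ℂ) (N : ℕ) :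
    ∃ (Q : MvPolynomial (Fin d) ℂ) (C δ : ℝ), 0 < δ ∧
      (∀ u, ‖u‖ < δ → ‖L (planeWave K u) - MvPolynomial.eval (fun i => (u i : ℂ)) Q‖ ≤
        C * ‖u‖ ^ (N + 1)) ∧
      ∀ m : Fin d →₀ ℕ, m.degree ≤ N → Q.coeff m = 0 → L (monomialOn K m) = 0 := by
  classical
  let e : (Fin d → ℕ) → (Fin d →₀ ℕ) := Finsupp.equivFunOnFinite.symm
  -- These are the coefficients of `(i⟨u,t⟩)^j / j!` expanded by the multinomial theorem. None
  -- needed below is zero, so a vanishing coefficient of `Q` means a vanishing moment of `L`.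
  let b : ℕ → (Fin d → ℕ) → ℂ := fun j k =>
    Complex.I ^ j / j.factorial * (Nat.multinomial Finset.univ k : ℂ)
  let S : ℕ → Finset (Fin d → ℕ) := fun j => Finset.piAntidiag Finset.univ j
  let Q : MvPolynomial (Fin d) ℂ := ∑ j ∈ Finset.range (N + 1), ∑ k ∈ S j,
    MvPolynomial.monomial (e k) (b j k * L (monomialOn K (e k)))
  obtain ⟨R, hR0, hR⟩ : ∃ R : ℝ, 0 < R ∧ ∀ t : K, ‖t.1‖ ≤ R := by
    have hK : IsCompact K := isCompact_iff_compactSpace.2 inferInstance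
    obtain ⟨R, hR0, hR⟩ := hK.isBounded.exists_pos_norm_le
    exact ⟨R, hR0, fun t => hR _ t.2⟩
  let D : ℝ := R ^ (N + 1) * (((N + 1).succ : ℝ) * ((N + 1).factorial * (N + 1 : ℕ) : ℝ)⁻¹)
  have hD : 0 ≤ D := by positivity
  -- The radius `R⁻¹` ensures `|⟨u,t⟩| ≤ 1` on `K`, as required by `Complex.exp_bound`, whose
  -- constant times `R^(N+1)` is `D`.
  refine ⟨Q, ‖L‖ * D, R⁻¹, by positivity, fun u hu => ?_, fun m hm hQm => ?_⟩
  · have hQ : MvPolynomial.eval (fun i => (u i : ℂ)) Q =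
        L (∑ j ∈ Finset.range (N + 1), ∑ k ∈ S j,
          (b j k * monomialFun (e k) u) • monomialOn K (e k)) := by
      simp only [Q, map_sum, monomial_eval_eq, map_smul, smul_eq_mul]
      refine Finset.sum_congr rfl fun j _ => Finset.sum_congr rfl fun k _ => by ring
    rw [hQ, ← map_sub, mul_assoc]
    refine (L.le_opNorm _).trans (mul_le_mul_of_nonneg_left ?_ (norm_nonneg _))
    refine (ContinuousMap.norm_le _ (by positivity)).2 fun t => ?_
    set z : ℂ := Complex.I * ((inner ℝ u t.1 : ℝ) : ℂ) with hz
    have hzn : ‖z‖ ≤ ‖u‖ * R := by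
      rw [hz, norm_mul, Complex.norm_I, one_mul, Complex.norm_real]
      exact (norm_inner_le_norm _ _).trans (mul_le_mul_of_nonneg_left (hR t) (norm_nonneg _))
    have hz1 : ‖z‖ ≤ 1 := hzn.trans (by
      have := mul_le_mul_of_nonneg_right hu.le hR0.le
      rwa [inv_mul_cancel₀ hR0.ne'] at this)
    have hexp : planeWave K u t = Complex.exp z := by
      simp only [planeWave, ContinuousMap.coe_mk, wave, hz]
      congr 1
      rw [inner_neg_right]
      push_cast; ring
    have hsum : (∑ j ∈ Finset.range (N + 1), ∑ k ∈ S j,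
          (b j k * monomialFun (e k) u) • monomialOn K (e k)) t =
        ∑ j ∈ Finset.range (N + 1), z ^ j / j.factorial := by
      simp only [ContinuousMap.sum_apply, ContinuousMap.smul_apply, smul_eq_mul]
      refine Finset.sum_congr rfl fun j _ => ?_
      have hin : ((inner ℝ u t.1 : ℝ) : ℂ) = ∑ i, (u i : ℂ) * (t.1 i : ℂ) := by
        simp [PiLp.inner_apply, mul_comm]
      rw [hz, mul_pow, hin, Finset.sum_pow_eq_sum_piAntidiag, Finset.mul_sum, Finset.sum_div]
      refine Finset.sum_congr rfl fun k _ => ?_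
      simp only [b, e, monomialOn, monomialFun, ContinuousMap.coe_mk, mul_pow,
        Finset.prod_mul_distrib, Finsupp.equivFunOnFinite_symm_apply_apply]
      push_cast
      ring
    rw [ContinuousMap.sub_apply, hexp, hsum]
    refine (Complex.exp_bound hz1 (Nat.succ_pos N)).trans ?_
    have h1 : ‖z‖ ^ (N + 1) ≤ (‖u‖ * R) ^ (N + 1) := pow_le_pow_left₀ (norm_nonneg _) hzn _
    calc _ ≤ (‖u‖ * R) ^ (N + 1) * (((N + 1).succ : ℝ) * ((N + 1).factorial * (N + 1 : ℕ) : ℝ)⁻¹) :=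
          mul_le_mul_of_nonneg_right h1 (by positivity)
      _ = D * ‖u‖ ^ (N + 1) := by simp only [D]; ring
  · have hc : Q.coeff m = b m.degree m * L (monomialOn K m) := by
      simp only [Q, MvPolynomial.coeff_sum, MvPolynomial.coeff_monomial]
      have hem : e m = m := Finsupp.equivFunOnFinite.symm_apply_apply m
      have hek : ∀ k, e k = m ↔ k = m := fun k => by
        rw [← hem]; exact Finsupp.equivFunOnFinite.symm.injective.eq_iff
      simp only [hek]
      rw [Finset.sum_eq_single m.degree]
      · rw [Finset.sum_eq_single (m : Fin d → ℕ)]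
        · simp [hem]
        · intro k _ hk; simp [hk]
        · intro h
          exact absurd (Finset.mem_piAntidiag.2 ⟨(Finsupp.degree_eq_sum m).symm, by simp⟩) h
      · intro j _ hj
        refine Finset.sum_eq_zero fun k hk => ?_
        rw [if_neg]
        rintro rfl
        exact hj ((Finset.mem_piAntidiag.1 hk).1.symm.trans (Finsupp.degree_eq_sum m).symm)
      · intro h; exact absurd (Finset.mem_range.2 (by omega)) h
    rw [hc] at hQm
    refine (mul_eq_zero.1 hQm).resolve_left ?_
    have : (Nat.multinomial Finset.univ (m : Fin d → ℕ) : ℂ) ≠ 0 := by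
      exact_mod_cast (Nat.multinomial_pos _ _).ne'
    simp only [b]
    refine mul_ne_zero (div_ne_zero (pow_ne_zero _ Complex.I_ne_zero) ?_) this
    exact_mod_cast Nat.factorial_ne_zero _

end Functional

/-! ### The symmetrized windowed spectral measure. -/

section Symmetrization

variable {d : ℕ}

/-- The measure `|f̂|² S + a δ₀`. -/
noncomputable def windowedMeasure (S : Measure (Rd d)) (f : Rd d → ℝ) (a : ℝ≥0∞) :
    Measure (Rd d) :=
  S.withDensity (fun u => ‖fourierHat f u‖ₑ ^ 2) + a • Measure.dirac 0

theorem mutuallySingular_map_neg {τ : Measure (Rd d)} (h : τ ⟂ₘ (volume : Measure (Rd d))) :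
    τ.map (fun u => -u) ⟂ₘ (volume : Measure (Rd d)) := by
  obtain ⟨N, hN, h1, h2⟩ := h
  refine ⟨(fun u => -u) ⁻¹' N, measurable_neg hN, ?_, ?_⟩
  · rw [Measure.map_apply measurable_neg (measurable_neg hN)]
    simpa [← Set.preimage_comp, Function.comp_def] using h1
  · rw [← Set.preimage_compl]
    have := Measure.map_apply (μ := (volume : Measure (Rd d))) measurable_neg hN.compl
    rw [← this, Measure.map_neg_eq_self]
    exact h2

theorem map_neg_withDensity (q : Rd d → ℝ≥0∞) :
    ((volume : Measure (Rd d)).withDensity q).map (fun u => -u) =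
      (volume : Measure (Rd d)).withDensity (fun u => q (-u)) := by
  ext B hB
  rw [Measure.map_apply measurable_neg hB, withDensity_apply _ (measurable_neg hB),
    withDensity_apply _ hB, ← lintegral_indicator (measurable_neg hB), ← lintegral_indicator hB,
    ← lintegral_neg_eq_self]
  refine lintegral_congr fun u => ?_
  by_cases hu : u ∈ B
  · simp [Set.indicator, hu]
  · simp [Set.indicator, hu]

/-- Lebesgue decomposition of the symmetrized windowed measure. -/
theorem exists_symm_windowedMeasure_eq (hd : 0 < d) {S : Measure (Rd d)} {s : Rd d → ℝ≥0∞}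
    (hs : IsSpectralDensity S s) {f : Rd d → ℝ} (hf : Measurable (fourierHat f)) (a : ℝ≥0∞) :
    ∃ τ : Measure (Rd d), τ ⟂ₘ (volume : Measure (Rd d)) ∧
      windowedMeasure S f a + (windowedMeasure S f a).map (fun u => -u) =
        τ + (volume : Measure (Rd d)).withDensity
          (fun u => ‖fourierHat f u‖ₑ ^ 2 * (s u + s (-u))) := by
  have : Nonempty (Fin d) := ⟨⟨0, hd⟩⟩
  obtain ⟨hsm, ν, hν, hS⟩ := hs
  set e : Rd d → ℝ≥0∞ := fun u => ‖fourierHat f u‖ₑ ^ 2 with he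
  have hem : Measurable e := by fun_prop
  set τ := ν.withDensity e + a • Measure.dirac 0 with hτ
  have hτs : τ ⟂ₘ (volume : Measure (Rd d)) := by
    refine Measure.MutuallySingular.add_left ?_ ?_
    · exact hν.mono_ac (withDensity_absolutelyContinuous _ _) Measure.AbsolutelyContinuous.rfl
    · exact (mutuallySingular_dirac 0 volume).mono_ac
        (Measure.smul_absolutelyContinuous) Measure.AbsolutelyContinuous.rfl
  have hT : windowedMeasure S f a = τ + (volume : Measure (Rd d)).withDensity (s * e) := by
    rw [windowedMeasure, hS, withDensity_add_measure, withDensity_mul _ hsm hem, hτ]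
    abel
  refine ⟨τ + τ.map (fun u => -u), hτs.add_left (mutuallySingular_map_neg hτs), ?_⟩
  have hq : (fun u => ‖fourierHat f u‖ₑ ^ 2 * (s u + s (-u))) =
      (s * e) + fun u => (s * e) (-u) := by
    funext u
    have : ‖fourierHat f (-u)‖ₑ = ‖fourierHat f u‖ₑ := by
      rw [← ofReal_norm, norm_fourierHat_neg, ofReal_norm]
    simp only [Pi.add_apply, Pi.mul_apply, he, this]
    ring
  rw [hT, hq, Measure.map_add _ _ measurable_neg, map_neg_withDensity,
    withDensity_add_left (hsm.mul hem)]
  abel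

/-- A functional dominated by the spectral measure annihilates the monomials of low degree. -/
theorem apply_monomialOn_eq_zero (hd : 0 < d) {S : Measure (Rd d)} {s : Rd d → ℝ≥0∞}
    (hs : IsSpectralDensity S s) {N : ℕ}
    (hN : ∀ ε : ℝ, 0 < ε → ∫⁻ u in Metric.ball (0 : Rd d) ε,
      (radialSup s u)⁻¹ * ENNReal.ofReal (‖u‖ ^ (2 * N)) = ∞)
    {f : Rd d → ℝ} (hfint : Integrable (fourierHat f)) (hfc : Continuous (fourierHat f))
    (hf0 : fourierHat f 0 ≠ 0) {c : ℝ} (hc : 0 < c) {a : ℝ≥0∞}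
    [IsFiniteMeasure (windowedMeasure S f a)] {K : Set (Rd d)} [CompactSpace K]
    (L : C(K, ℂ) →L[ℂ] ℂ) {A : ℝ≥0∞} (hA : A ≠ ∞)
    (h : ∀ b, ‖∫ u, trig b u * (c * fourierHat f u * L (planeWave K u))‖ₑ ≤ A * eLpNorm (trig b) 2
      (windowedMeasure S f a + (windowedMeasure S f a).map (fun u => -u)))
    {m : Fin d →₀ ℕ} (hm : m.degree ≤ N) : L (monomialOn K m) = 0 := by
  set M : Rd d → ℂ := fun u => L (planeWave K u) with hM
  have hMc : Continuous M := L.continuous.comp continuous_planeWave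
  have hMb : ∀ u, ‖M u‖ ≤ ‖L‖ := fun u =>
    (L.le_opNorm _).trans (mul_le_of_le_one_right (norm_nonneg _) (norm_planeWave_le u))
  set F : Rd d → ℂ := fun u => c * fourierHat f u * M u with hF
  have hFc : Continuous F := by fun_prop
  have hFi : Integrable F :=
    (hfint.const_mul _).mul_bdd (c := ‖L‖) hMc.aestronglyMeasurable (ae_of_all _ hMb)
  have hFb : ∀ u, ‖F u‖ ≤ c * (∫ t, ‖f t‖) * ‖L‖ := fun u => by
    rw [hF]
    simp only [norm_mul, Complex.norm_real, Real.norm_of_nonneg hc.le]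
    gcongr
    · exact norm_fourierHat_le f u
    · exact hMb u
  obtain ⟨τ, hτ, hT⟩ := exists_symm_windowedMeasure_eq hd hs hfc.measurable a
  have hsm := hs.1
  have : IsFiniteMeasure ((windowedMeasure S f a).map (fun u => -u)) :=
    Measure.isFiniteMeasure_map _ _
  have hmain := lintegral_enorm_sq_mul_inv_le (by fun_prop) hτ hT hFi hFc.measurable hFb hA h
  obtain ⟨Q, C, δ, hδ, hQ, hQm⟩ := exists_taylor L N
  apply hQm m hm
  obtain ⟨η, hη, hηs⟩ := Metric.eventually_nhds_iff.1 (hfc.continuousAt.eventually_ne hf0)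
  have hfin : ∫⁻ u in Metric.ball (0 : Rd d) (min δ η), (radialSup s u)⁻¹ * ‖M u‖ₑ ^ 2 < ∞ := by
    -- The factor `1/2` comes from `s(u) + s(-u) ≤ 2 s̃(u)`; the powers of `|f̂|` cancel because
    -- `f̂` is nonzero on the ball of radius `η`.
    set κ : ℝ≥0∞ := ENNReal.ofReal c ^ 2 * 2⁻¹ with hκ
    have hκ0 : κ ≠ 0 := mul_ne_zero (by simpa using hc) (by simp)
    have hκt : κ ≠ ∞ := by finiteness
    have hle : ∀ u ∈ Metric.ball (0 : Rd d) (min δ η), κ * ((radialSup s u)⁻¹ * ‖M u‖ₑ ^ 2) ≤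
        ‖F u‖ₑ ^ 2 * (‖fourierHat f u‖ₑ ^ 2 * (s u + s (-u)))⁻¹ := by
      intro u hu
      have hu0 : fourierHat f u ≠ 0 := hηs ((Metric.mem_ball.1 hu).trans_le (min_le_right _ _))
      set E := ‖fourierHat f u‖ₑ ^ 2 with hE
      have hE0 : E ≠ 0 := by simpa [hE] using hu0
      have hEt : E ≠ ∞ := by finiteness
      have h1 : s u + s (-u) ≤ 2 * radialSup s u := by
        rw [two_mul]
        exact add_le_add (le_radialSup s rfl) (le_radialSup s (norm_neg u))
      have h2 : ‖F u‖ₑ ^ 2 = ENNReal.ofReal c ^ 2 * E * ‖M u‖ₑ ^ 2 := by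
        have : ‖(c : ℂ)‖ₑ = ENNReal.ofReal c := by
          rw [← ofReal_norm, Complex.norm_real, Real.norm_of_nonneg hc.le]
        simp only [hF, enorm_mul, this, mul_pow, hE]
      rw [h2, ENNReal.mul_inv (Or.inl hE0) (Or.inl hEt)]
      calc κ * ((radialSup s u)⁻¹ * ‖M u‖ₑ ^ 2)
          = ENNReal.ofReal c ^ 2 * ‖M u‖ₑ ^ 2 * (2⁻¹ * (radialSup s u)⁻¹) := by rw [hκ]; ring
        _ = ENNReal.ofReal c ^ 2 * ‖M u‖ₑ ^ 2 * (2 * radialSup s u)⁻¹ := by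
            rw [ENNReal.mul_inv (Or.inl (by simp)) (Or.inl (by simp))]
        _ ≤ ENNReal.ofReal c ^ 2 * ‖M u‖ₑ ^ 2 * (s u + s (-u))⁻¹ := by
            gcongr
        _ = (E * E⁻¹) * (ENNReal.ofReal c ^ 2 * ‖M u‖ₑ ^ 2 * (s u + s (-u))⁻¹) := by
            rw [ENNReal.mul_inv_cancel hE0 hEt, one_mul]
        _ = _ := by ring
    have hint : κ * ∫⁻ u in Metric.ball (0 : Rd d) (min δ η), (radialSup s u)⁻¹ * ‖M u‖ₑ ^ 2 < ∞ := by
      rw [← lintegral_const_mul' _ _ hκt]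
      refine (setLIntegral_mono' measurableSet_ball hle).trans_lt ?_
      exact (setLIntegral_le_lintegral _ _).trans_lt (hmain.trans_lt (by finiteness))
    exact (ENNReal.mul_lt_top_iff.1 hint).elim (fun h => h.2)
      (fun h => h.elim (fun h => absurd h hκ0) fun h => h ▸ ENNReal.zero_lt_top)
  have hcomp := homogeneousComponent_eq_zero_of_lintegral_lt_top hd
    (fun u v huv => congrArg (·⁻¹) (radialSup_radial s u v huv)) hN hMc.measurable Q
    (lt_min hδ hη) (fun u hu => hQ u (hu.trans_le (min_le_left _ _))) hfin hm
  have := congrArg (MvPolynomial.coeff m) hcomp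
  rwa [MvPolynomial.coeff_homogeneousComponent, if_pos rfl] at this

end Symmetrization

/-! ### Continuity of the linear statistics under uniform convergence. -/

section RandomMeasure

variable {d : ℕ}

theorem isTestFun_zero : IsTestFun (0 : Rd d → ℝ) :=
  ⟨measurable_const, ⟨0, by simp⟩, HasCompactSupport.zero⟩

theorem IsTestFun.add {f g : Rd d → ℝ} (hf : IsTestFun f) (hg : IsTestFun g) :
    IsTestFun (f + g) := by
  obtain ⟨C, hC⟩ := hf.bounded
  obtain ⟨D, hD⟩ := hg.bounded
  exact ⟨hf.measurable.add hg.measurable,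
    ⟨C + D, fun t => (abs_add_le _ _).trans (add_le_add (hC t) (hD t))⟩,
    hf.compactSupport.add hg.compactSupport⟩

theorem IsTestFun.smul {f : Rd d → ℝ} (hf : IsTestFun f) (c : ℝ) : IsTestFun (c • f) := by
  obtain ⟨C, hC⟩ := hf.bounded
  refine ⟨hf.measurable.const_smul c, ⟨|c| * C, fun t => ?_⟩, ?_⟩
  · simp only [Pi.smul_apply, smul_eq_mul, abs_mul]
    exact mul_le_mul_of_nonneg_left (hC t) (abs_nonneg _)
  · exact hf.compactSupport.smul_left (f := fun _ => c)

theorem IsTestFun.translate {f : Rd d → ℝ} (hf : IsTestFun f) (x : Rd d) :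
    IsTestFun fun t => f (t - x) := by
  obtain ⟨C, hC⟩ := hf.bounded
  exact ⟨hf.measurable.comp (measurable_sub_const x), ⟨C, fun t => hC _⟩,
    hf.compactSupport.comp_homeomorph (Homeomorph.subRight x)⟩

theorem isTestFun_of_eq_zero_off {f : Rd d → ℝ} (hf : Measurable f) {C : ℝ} (hC : ∀ t, |f t| ≤ C)
    {A : Set (Rd d)} (hA : Bornology.IsBounded A) (hfA : ∀ t ∉ A, f t = 0) : IsTestFun f :=
  ⟨hf, ⟨C, hC⟩, HasCompactSupport.intro' hA.isCompact_closure isClosed_closure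
    fun t ht => hfA t fun h => ht (subset_closure h)⟩

/-- The space of test functions. -/
def testSpace (d : ℕ) : Submodule ℝ (Rd d → ℝ) where
  carrier := {f | IsTestFun f}
  add_mem' hf hg := IsTestFun.add hf hg
  zero_mem' := isTestFun_zero
  smul_mem' c _ hf := IsTestFun.smul hf c

variable {Ω : Type*} [MeasurableSpace Ω] {P : Measure Ω} {I : (Rd d → ℝ) → Ω → ℝ}

namespace IsStationaryRandomMeasure

variable (hI : IsStationaryRandomMeasure P I)
include hI

theorem sub {f g : Rd d → ℝ} (hf : IsTestFun f) (hg : IsTestFun g) :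
    I (f - g) =ᵐ[P] I f - I g := by
  have h1 := hI.add f ((-1 : ℝ) • g) hf (hg.smul _)
  have h2 := hI.smul (-1) g hg
  have e : f - g = f + (-1 : ℝ) • g := by simp [sub_eq_add_neg]
  rw [e]
  filter_upwards [h1, h2] with ω h3 h4
  simp only [Pi.add_apply, Pi.smul_apply, smul_eq_mul, Pi.sub_apply] at *
  rw [h3, h4]; ring

end IsStationaryRandomMeasure

/-- The linear statistics as a linear map from test functions to `L²`. -/
noncomputable def statistic (hI : IsStationaryRandomMeasure P I) : testSpace d →ₗ[ℝ] Lp ℝ 2 P where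
  toFun f := (hI.memLp f.1 f.2).toLp (I f.1)
  map_add' f g := by
    rw [← MemLp.toLp_add]
    exact (MemLp.toLp_eq_toLp_iff _ _).2 (hI.add f.1 g.1 f.2 g.2)
  map_smul' c f := by
    rw [RingHom.id_apply, ← MemLp.toLp_const_smul]
    exact (MemLp.toLp_eq_toLp_iff _ _).2 (hI.smul c f.1 f.2)

theorem coeFn_statistic (hI : IsStationaryRandomMeasure P I) (f : testSpace d) :
    statistic hI f =ᵐ[P] I f.1 := (hI.memLp f.1 f.2).coeFn_toLp

/-- Statistics of non-negative test functions decaying geometrically tend to `0` almost surely. -/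
theorem ae_tendsto_zero_of_nonneg (hI : IsStationaryRandomMeasure P I) {A : Set (Rd d)}
    (hA : Bornology.IsBounded A) {f : ℕ → Rd d → ℝ} (hf : ∀ n, IsTestFun (f n))
    (hf0 : ∀ n t, 0 ≤ f n t) (hfb : ∀ n t, f n t ≤ (1 / 2) ^ n) (hfA : ∀ n, ∀ t ∉ A, f n t = 0) :
    ∀ᵐ ω ∂P, Tendsto (fun n => I (f n) ω) atTop (𝓝 0) := by
  have hsum : ∀ t, Summable fun n => f n t := fun t =>
    Summable.of_nonneg_of_le (fun n => hf0 n t) (fun n => hfb n t) summable_geometric_two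
  -- The sum is again a test function, so countable additivity makes the series of statistics
  -- converge almost surely, and its general term tends to `0`.
  have hg : IsTestFun fun t => ∑' n, f n t := by
    refine isTestFun_of_eq_zero_off (C := ∑' n : ℕ, (1 / 2 : ℝ) ^ n) ?_ (fun t => ?_) hA fun t ht => ?_
    · exact measurable_of_tendsto_metrizable
        (f := fun N t => ∑ n ∈ Finset.range N, f n t)
        (fun N => Finset.measurable_sum _ fun n _ => (hf n).measurable)
        (tendsto_pi_nhds.2 fun t => (hsum t).hasSum.tendsto_sum_nat)
    · rw [abs_of_nonneg (tsum_nonneg fun n => hf0 n t)]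
      exact (hsum t).tsum_le_tsum (fun n => hfb n t) summable_geometric_two
    · simp [hfA _ t ht]
  filter_upwards [hI.sigma_additive f _ hf hg hf0 fun t => (hsum t).hasSum] with ω hω
  have h2 := ((tendsto_add_atTop_iff_nat 1).2 hω).sub hω
  rw [sub_self] at h2
  exact h2.congr fun n => by rw [Finset.sum_range_succ]; ring

theorem ae_tendsto_zero_of_abs_le (hI : IsStationaryRandomMeasure P I) {A : Set (Rd d)}
    (hA : Bornology.IsBounded A) {f : ℕ → Rd d → ℝ} (hf : ∀ n, IsTestFun (f n))
    (hfb : ∀ n t, |f n t| ≤ (1 / 2) ^ n) (hfA : ∀ n, ∀ t ∉ A, f n t = 0) :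
    ∀ᵐ ω ∂P, Tendsto (fun n => I (f n) ω) atTop (𝓝 0) := by
  have hp : ∀ n, IsTestFun fun t => max (f n t) 0 := fun n =>
    isTestFun_of_eq_zero_off ((hf n).measurable.max measurable_const) (C := (1 / 2) ^ n)
      (fun t => by
        rw [abs_of_nonneg (le_max_right _ _)]
        exact max_le ((le_abs_self _).trans (hfb n t)) (by positivity)) hA
      fun t ht => by simp [hfA n t ht]
  have hm : ∀ n, IsTestFun fun t => max (-f n t) 0 := fun n =>
    isTestFun_of_eq_zero_off ((hf n).measurable.neg.max measurable_const) (C := (1 / 2) ^ n)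
      (fun t => by
        rw [abs_of_nonneg (le_max_right _ _)]
        exact max_le ((neg_le_abs _).trans (hfb n t)) (by positivity)) hA
      fun t ht => by simp [hfA n t ht]
  have h1 := ae_tendsto_zero_of_nonneg hI hA hp (fun n t => le_max_right _ _)
    (fun n t => max_le ((le_abs_self _).trans (hfb n t)) (by positivity))
    fun n t ht => by simp [hfA n t ht]
  have h2 := ae_tendsto_zero_of_nonneg hI hA hm (fun n t => le_max_right _ _)
    (fun n t => max_le ((neg_le_abs _).trans (hfb n t)) (by positivity))
    fun n t ht => by simp [hfA n t ht]
  have h3 : ∀ᵐ ω ∂P, ∀ n, I (f n) ω =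
      I (fun t => max (f n t) 0) ω - I (fun t => max (-f n t) 0) ω := by
    rw [ae_all_iff]
    intro n
    have e : f n = (fun t => max (f n t) 0) - fun t => max (-f n t) 0 := by
      funext t
      simp only [Pi.sub_apply]
      rcases le_total 0 (f n t) with h | h
      · rw [max_eq_left h, max_eq_right (by linarith)]; ring
      · rw [max_eq_right h, max_eq_left (by linarith)]; ring
    have h4 := hI.sub (hp n) (hm n)
    rw [← e] at h4
    exact h4
  filter_upwards [h1, h2, h3] with ω a b c
  simp only [c]
  simpa using a.sub b

/-- Extension by `0` off `A` of the continuous functions on a compact set containing `A`. -/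
noncomputable def extendZero {A K : Set (Rd d)} [CompactSpace K] (hA : MeasurableSet A)
    (hAK : A ⊆ K) : C(K, ℝ) →ₗ[ℝ] testSpace d where
  toFun g := ⟨A.indicator (Function.extend Subtype.val g 0), by
    have hK : IsCompact K := isCompact_iff_compactSpace.2 inferInstance
    refine isTestFun_of_eq_zero_off (C := ‖g‖) (A := A) ?_ ?_ (hK.isBounded.subset hAK) ?_
    · exact ((MeasurableEmbedding.subtype_coe hK.measurableSet).measurable_extend
        g.continuous.measurable measurable_const).indicator hA
    · intro t
      by_cases ht : t ∈ A
      · rw [Set.indicator_of_mem ht,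
          show t = ((⟨t, hAK ht⟩ : K) : Rd d) from rfl, Subtype.val_injective.extend_apply]
        exact g.norm_coe_le_norm _
      · simp [ht]
    · intro t ht; simp [ht]⟩
  map_add' g h := by
    ext t
    by_cases ht : t ∈ A
    · have hx : ∀ g : C(K, ℝ), Function.extend Subtype.val g 0 t = g ⟨t, hAK ht⟩ := fun g =>
        Subtype.val_injective.extend_apply g 0 (⟨t, hAK ht⟩ : K)
      simp only [Submodule.coe_add, Pi.add_apply, Set.indicator_of_mem ht]
      rw [hx, hx, hx, ContinuousMap.add_apply]
    · simp [ht]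
  map_smul' c g := by
    ext t
    by_cases ht : t ∈ A
    · have hx : ∀ g : C(K, ℝ), Function.extend Subtype.val g 0 t = g ⟨t, hAK ht⟩ := fun g =>
        Subtype.val_injective.extend_apply g 0 (⟨t, hAK ht⟩ : K)
      simp only [Submodule.coe_smul, Pi.smul_apply, Set.indicator_of_mem ht, RingHom.id_apply]
      rw [hx, hx, ContinuousMap.smul_apply]
    · simp [ht]

theorem extendZero_apply_of_mem {A K : Set (Rd d)} [CompactSpace K] (hA : MeasurableSet A)
    (hAK : A ⊆ K) (g : C(K, ℝ)) {t : Rd d} (ht : t ∈ A) :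
    (extendZero hA hAK g : Rd d → ℝ) t = g ⟨t, hAK ht⟩ := by
  change A.indicator (Function.extend Subtype.val g 0) t = _
  rw [Set.indicator_of_mem ht]
  exact Subtype.val_injective.extend_apply g 0 (⟨t, hAK ht⟩ : K)

theorem extendZero_apply_of_notMem {A K : Set (Rd d)} [CompactSpace K] (hA : MeasurableSet A)
    (hAK : A ⊆ K) (g : C(K, ℝ)) {t : Rd d} (ht : t ∉ A) :
    (extendZero hA hAK g : Rd d → ℝ) t = 0 :=
  Set.indicator_of_notMem ht _

/-- By the closed graph theorem, the linear statistics are continuous for uniform convergence. -/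
theorem continuous_statistic_extendZero [IsProbabilityMeasure P]
    (hI : IsStationaryRandomMeasure P I) {A K : Set (Rd d)} [CompactSpace K]
    (hA : MeasurableSet A) (hAK : A ⊆ K) :
    Continuous ((statistic hI).comp (extendZero hA hAK)) := by
  have hK : IsCompact K := isCompact_iff_compactSpace.2 inferInstance
  refine LinearMap.continuous_of_seq_closed_graph _ fun u x y hu hy => ?_
  set Λ := (statistic hI).comp (extendZero hA hAK) with hΛ
  have hv : Tendsto (fun n => u n - x) atTop (𝓝 0) := by
    simpa using hu.sub (tendsto_const_nhds (x := x))
  have hz : Tendsto (fun n => Λ (u n - x)) atTop (𝓝 (y - Λ x)) := by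
    simp only [map_sub]
    exact hy.sub tendsto_const_nhds
  -- Along a geometrically fast subsequence the statistics tend to `0` almost surely; they also tend
  -- to `y - Λ x` in `L²`, and both limits hold in measure, so they coincide.
  have hφ : ∀ n : ℕ, ∃ N, ∀ k ≥ N, ‖u k - x‖ ≤ (1 / 2) ^ n := fun n => by
    have := hv.norm
    rw [norm_zero] at this
    exact eventually_atTop.1 (this.eventually (ge_mem_nhds (by positivity)))
  obtain ⟨φ, hφm, hφb⟩ := extraction_forall_of_eventually'
    (P := fun n k => ‖u k - x‖ ≤ (1 / 2) ^ n) hφ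
  have hae := ae_tendsto_zero_of_abs_le hI (A := A) (hK.isBounded.subset hAK)
    (f := fun n => (extendZero hA hAK (u (φ n) - x)).1) (fun n => (extendZero hA hAK _).2)
    (fun n t => by
      by_cases ht : t ∈ A
      · rw [extendZero_apply_of_mem hA hAK _ ht]
        exact ((u (φ n) - x).norm_coe_le_norm _).trans (hφb n)
      · rw [extendZero_apply_of_notMem hA hAK _ ht]; simp)
    (fun n t ht => extendZero_apply_of_notMem hA hAK _ ht)
  have h1 : TendstoInMeasure P (fun n => (Λ (u (φ n) - x) : Ω → ℝ)) atTop (0 : Ω → ℝ) := by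
    refine tendstoInMeasure_of_tendsto_ae (fun n => Lp.aestronglyMeasurable _) ?_
    have h2 : ∀ᵐ ω ∂P, ∀ n, Λ (u (φ n) - x) ω = I (extendZero hA hAK (u (φ n) - x)).1 ω :=
      ae_all_iff.2 fun n => coeFn_statistic hI _
    filter_upwards [hae, h2] with ω a b
    simpa only [b, Pi.zero_apply] using a
  have h3 := tendstoInMeasure_of_tendsto_Lp (hz.comp hφm.tendsto_atTop)
  have h4 := tendstoInMeasure_ae_unique h3 h1
  have h5 : y - Λ x = 0 := (Lp.eq_zero_iff_ae_eq_zero).2 h4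
  exact sub_eq_zero.1 h5

end RandomMeasure

/-! ### Orthogonality, spectral bounds and rigidity. -/

section Rigidity

variable {d : ℕ} {Ω : Type*} [MeasurableSpace Ω] {P : Measure Ω} [IsProbabilityMeasure P]
  {I : (Rd d → ℝ) → Ω → ℝ}

/-- The second moment is variance plus squared mean; the inequality suffices and avoids justifying
the truncated subtraction in `evariance_def'`. -/
theorem enorm_statistic_sq_le (hI : IsStationaryRandomMeasure P I) (f : testSpace d) :
    ‖statistic hI f‖ₑ ^ 2 ≤ evariance (I f.1) P + ENNReal.ofReal ((∫ ω, I f.1 ω ∂P) ^ 2) := by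
  have h1 : ‖statistic hI f‖ₑ = eLpNorm (I f.1) 2 P := Lp.enorm_toLp (hI.memLp f.1 f.2)
  have h2 : eLpNorm (I f.1) 2 P ^ 2 = ∫⁻ ω, ‖I f.1 ω‖ₑ ^ 2 ∂P := by
    have := eLpNorm_nnreal_pow_eq_lintegral (f := I f.1) (μ := P) (p := 2) (by norm_num)
    simpa using this
  rw [h1, h2, evariance_def' (hI.memLp f.1 f.2).aestronglyMeasurable]
  exact le_tsub_add

/-- The translate of a test function, as a test function. -/
def translateTest (f : testSpace d) (x : Rd d) : testSpace d :=
  ⟨fun t => f.1 (t - x), IsTestFun.translate f.2 x⟩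

theorem fourierHat_sum_translate (f : testSpace d) (s : Finset (Rd d)) (a : Rd d → ℝ) (u : Rd d) :
    fourierHat (∑ x ∈ s, a x • translateTest f x : testSpace d).1 u =
      (∑ x ∈ s, a x * wave x u) * fourierHat f.1 u := by
  rw [Finset.sum_mul]
  have h1 : ∀ t, (((∑ x ∈ s, a x • translateTest f x : testSpace d).1 t : ℝ) : ℂ) =
      ∑ x ∈ s, (a x : ℂ) * ((f.1 (t - x) : ℝ) : ℂ) := fun t => by
    simp [translateTest]
  rw [fourierHat_eq_wave]
  simp only [h1, Finset.mul_sum]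
  rw [integral_finsetSum]
  · refine Finset.sum_congr rfl fun x _ => ?_
    rw [mul_assoc, ← fourierHat_translate, fourierHat_eq_wave, ← integral_const_mul]
    refine integral_congr_ae (ae_of_all _ fun t => ?_)
    simp only []
    ring
  · intro x _
    have := (integrable_wave_mul_testFun (IsTestFun.translate f.2 x) u).const_mul (a x : ℂ)
    refine this.congr (ae_of_all _ fun t => ?_)
    simp only []
    ring

theorem integral_sum_translate (hI : IsStationaryRandomMeasure P I) (f : testSpace d)
    (s : Finset (Rd d)) (a : Rd d → ℝ) :
    ∫ ω, I (∑ x ∈ s, a x • translateTest f x : testSpace d).1 ω ∂P =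
      (∑ x ∈ s, a x) * ∫ ω, I f.1 ω ∂P := by
  let m : testSpace d → ℝ := fun g => ∫ ω, I g.1 ω ∂P
  have hint : ∀ g : testSpace d, Integrable (I g.1) P := fun g =>
    (hI.memLp g.1 g.2).integrable (by norm_num)
  have hadd : ∀ g h, m (g + h) = m g + m h := fun g h => by
    rw [← integral_add (hint g) (hint h)]
    exact integral_congr_ae (hI.add g.1 h.1 g.2 h.2)
  have hsmul : ∀ (c : ℝ) g, m (c • g) = c * m g := fun c g => by
    rw [← integral_const_mul]
    exact integral_congr_ae (hI.smul c g.1 g.2)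
  let m' : testSpace d →ₗ[ℝ] ℝ := { toFun := m, map_add' := hadd, map_smul' := hsmul }
  change m' (∑ x ∈ s, a x • translateTest f x) = _
  rw [map_sum, Finset.sum_mul]
  refine Finset.sum_congr rfl fun x _ => ?_
  rw [map_smul, smul_eq_mul]
  congr 1
  exact hI.mean_translate x f.1 f.2

theorem continuous_sum_wave (s : Finset (Rd d)) (a : Rd d → ℝ) :
    Continuous fun u => ∑ x ∈ s, (a x : ℂ) * wave x u :=
  continuous_finsetSum _ fun x _ => continuous_const.mul (continuous_wave x)

/-- Second moments of combinations of translates of one test function. -/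
theorem enorm_statistic_sum_translate_sq_le (hI : IsStationaryRandomMeasure P I)
    {S : Measure (Rd d)} (hS : IsSpectralMeasure P I S) (f : testSpace d)
    (hf : Measurable (fourierHat f.1)) (s : Finset (Rd d)) (a : Rd d → ℝ) :
    ‖statistic hI (∑ x ∈ s, a x • translateTest f x)‖ₑ ^ 2 ≤
      ∫⁻ u, ‖∑ x ∈ s, (a x : ℂ) * wave x u‖ₑ ^ 2
        ∂(windowedMeasure S f.1 (ENNReal.ofReal ((∫ ω, I f.1 ω ∂P) ^ 2))) := by
  refine (enorm_statistic_sq_le hI _).trans ?_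
  have hm : Measurable fun u => ‖∑ x ∈ s, (a x : ℂ) * wave x u‖ₑ ^ 2 :=
    (continuous_sum_wave s a).measurable.enorm.pow_const 2
  rw [hS _ (∑ x ∈ s, a x • translateTest f x : testSpace d).2, integral_sum_translate hI,
    windowedMeasure, lintegral_add_measure, lintegral_smul_measure,
    lintegral_dirac' _ hm, lintegral_withDensity_eq_lintegral_mul _ (by fun_prop) hm]
  refine add_le_add (le_of_eq (lintegral_congr fun u => ?_)) (le_of_eq ?_)
  · rw [fourierHat_sum_translate, enorm_mul, mul_pow, mul_comm]
    rfl
  · have h0 : ∑ x ∈ s, (a x : ℂ) * wave x 0 = ((∑ x ∈ s, a x : ℝ) : ℂ) := by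
      simp [wave]
    rw [h0, mul_pow, mul_comm, ENNReal.ofReal_mul (by positivity), smul_eq_mul]
    congr 1
    rw [← ofReal_norm, Complex.norm_real, ← ENNReal.ofReal_pow (norm_nonneg _), Real.norm_eq_abs,
      sq_abs]

/-- `S` itself may be infinite, but the mass of `|f̂|² S` is the variance of `I f`. -/
theorem isFiniteMeasure_windowedMeasure (hI : IsStationaryRandomMeasure P I)
    {S : Measure (Rd d)} (hS : IsSpectralMeasure P I S) {f : Rd d → ℝ} (hf : IsTestFun f)
    {a : ℝ≥0∞} (ha : a ≠ ∞) : IsFiniteMeasure (windowedMeasure S f a) := by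
  refine ⟨?_⟩
  rw [windowedMeasure, Measure.add_apply, withDensity_apply _ MeasurableSet.univ,
    Measure.restrict_univ, ← hS f hf]
  simp only [Measure.smul_apply, measure_univ, smul_eq_mul, mul_one]
  exact ENNReal.add_lt_top.2 ⟨evariance_lt_top (hI.memLp f hf), ha.lt_top⟩

/-- A real functional given on translates by an `L²` variable is bounded, also for complex
coefficients, by the symmetrized windowed measure. -/
theorem enorm_sum_inner_le (hI : IsStationaryRandomMeasure P I)
    {S : Measure (Rd d)} (hS : IsSpectralMeasure P I S) (f : testSpace d)
    (hf : Measurable (fourierHat f.1)) (X : Lp ℝ 2 P) (b : Rd d →₀ ℂ) :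
    ‖b.sum fun x z => z * ((inner ℝ X (statistic hI (translateTest f x)) : ℝ) : ℂ)‖ₑ ≤
      ‖X‖ₑ * eLpNorm (trig b) 2
        (windowedMeasure S f.1 (ENNReal.ofReal ((∫ ω, I f.1 ω ∂P) ^ 2)) +
          (windowedMeasure S f.1 (ENNReal.ofReal ((∫ ω, I f.1 ω ∂P) ^ 2))).map (fun u => -u)) := by
  set T := windowedMeasure S f.1 (ENNReal.ofReal ((∫ ω, I f.1 ω ∂P) ^ 2)) with hT
  set J : (Rd d → ℝ) → Lp ℝ 2 P := fun a =>
    statistic hI (∑ x ∈ b.support, a x • translateTest f x) with hJ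
  set φ : (Rd d → ℝ) → Rd d → ℂ := fun a u => ∑ x ∈ b.support, (a x : ℂ) * wave x u with hφ
  have hin : ∀ a : Rd d → ℝ, inner ℝ X (J a) =
      ∑ x ∈ b.support, a x * inner ℝ X (statistic hI (translateTest f x)) := fun a => by
    rw [hJ]
    simp only [map_sum, map_smul, inner_sum, inner_smul_right]
  -- The statistics are only real-linear, so the real and imaginary parts of the coefficients are
  -- treated separately.
  have hz : (b.sum fun x z => z * ((inner ℝ X (statistic hI (translateTest f x)) : ℝ) : ℂ)) =
      ((inner ℝ X (J fun x => (b x).re) : ℝ) : ℂ) +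
        ((inner ℝ X (J fun x => (b x).im) : ℝ) : ℂ) * Complex.I := by
    rw [hin, hin, Finsupp.sum]
    push_cast
    rw [Finset.sum_mul, ← Finset.sum_add_distrib]
    refine Finset.sum_congr rfl fun x _ => ?_
    conv_lhs => rw [← Complex.re_add_im (b x)]
    ring
  have hbd : ∀ a, ENNReal.ofReal ((inner ℝ X (J a)) ^ 2) ≤ ‖X‖ₑ ^ 2 * ∫⁻ u, ‖φ a u‖ₑ ^ 2 ∂T := by
    intro a
    refine le_trans ?_ (mul_le_mul_right
      (enorm_statistic_sum_translate_sq_le hI hS f hf b.support a) _)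
    have h1 := abs_real_inner_le_norm X (J a)
    have h2 : (inner ℝ X (J a)) ^ 2 ≤ ‖X‖ ^ 2 * ‖J a‖ ^ 2 := by
      rw [← mul_pow, ← sq_abs]
      exact pow_le_pow_left₀ (abs_nonneg _) h1 2
    refine (ENNReal.ofReal_le_ofReal h2).trans (le_of_eq ?_)
    rw [ENNReal.ofReal_mul (by positivity), ENNReal.ofReal_pow (norm_nonneg _),
      ENNReal.ofReal_pow (norm_nonneg _), ofReal_norm, ofReal_norm]
  -- With `p`, `q` the two parts, `p + iq` is `trig b u` and `p - iq` is the conjugate of `trig b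
  -- (-u)`; the parallelogram law recombines them at the cost of reflecting the measure.
  have hpt : ∀ u, ‖φ (fun x => (b x).re) u‖ₑ ^ 2 + ‖φ (fun x => (b x).im) u‖ₑ ^ 2 ≤
      ‖trig b u‖ₑ ^ 2 + ‖trig b (-u)‖ₑ ^ 2 := by
    intro u
    set p := φ (fun x => (b x).re) u with hp
    set q := φ (fun x => (b x).im) u with hq
    have h1 : trig b u = p + q * Complex.I := by
      rw [hp, hq, hφ, trig, Finsupp.sum]
      simp only []
      rw [Finset.sum_mul, ← Finset.sum_add_distrib]
      refine Finset.sum_congr rfl fun x _ => ?_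
      conv_lhs => rw [← Complex.re_add_im (b x)]
      ring
    have h2 : (starRingEnd ℂ) (trig b (-u)) = p - q * Complex.I := by
      rw [hp, hq, hφ, trig, Finsupp.sum]
      simp only []
      rw [Finset.sum_mul, ← Finset.sum_sub_distrib, map_sum]
      refine Finset.sum_congr rfl fun x _ => ?_
      conv_lhs => rw [← Complex.re_add_im (b x)]
      simp only [map_mul, map_add, Complex.conj_ofReal, Complex.conj_I, conj_wave, wave_neg_right,
        neg_neg]
      ring
    have h3 : ‖p‖ ^ 2 + ‖q‖ ^ 2 ≤ ‖trig b u‖ ^ 2 + ‖trig b (-u)‖ ^ 2 := by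
      have h4 := parallelogram_law_with_norm ℝ p (q * Complex.I)
      rw [← h1, ← h2, RCLike.norm_conj, norm_mul, Complex.norm_I, mul_one] at h4
      nlinarith [sq_nonneg ‖p‖, sq_nonneg ‖q‖]
    have h5 := ENNReal.ofReal_le_ofReal h3
    rw [ENNReal.ofReal_add (by positivity) (by positivity),
      ENNReal.ofReal_add (by positivity) (by positivity)] at h5
    simpa only [ENNReal.ofReal_pow (norm_nonneg _), ofReal_norm] using h5
  have htm : Measurable fun u => ‖trig b u‖ₑ ^ 2 := (continuous_trig b).measurable.enorm.pow_const 2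
  have hφm : Measurable fun u => ‖φ (fun x => (b x).re) u‖ₑ ^ 2 :=
    (continuous_sum_wave b.support fun x => (b x).re).measurable.enorm.pow_const 2
  have hsq : eLpNorm (trig b) 2 (T + T.map (fun u => -u)) ^ 2 =
      ∫⁻ u, (‖trig b u‖ₑ ^ 2 + ‖trig b (-u)‖ₑ ^ 2) ∂T := by
    have := eLpNorm_nnreal_pow_eq_lintegral (f := trig b) (μ := T + T.map (fun u => -u)) (p := 2)
      (by norm_num)
    rw [lintegral_add_left htm, ← lintegral_map htm measurable_neg, ← lintegral_add_measure]
    simpa using this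
  rw [← ENNReal.pow_le_pow_left_iff two_ne_zero, mul_pow, hsq, hz]
  have hnorm : ∀ α β : ℝ, ‖(α : ℂ) + (β : ℂ) * Complex.I‖ₑ ^ 2 =
      ENNReal.ofReal (α ^ 2) + ENNReal.ofReal (β ^ 2) := fun α β => by
    rw [← ofReal_norm, ← ENNReal.ofReal_pow (norm_nonneg _), ← ENNReal.ofReal_add (by positivity)
      (by positivity), ← Complex.normSq_eq_norm_sq, Complex.normSq_add_mul_I]
  rw [hnorm]
  calc _ ≤ ‖X‖ₑ ^ 2 * ∫⁻ u, ‖φ (fun x => (b x).re) u‖ₑ ^ 2 ∂T +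
        ‖X‖ₑ ^ 2 * ∫⁻ u, ‖φ (fun x => (b x).im) u‖ₑ ^ 2 ∂T := add_le_add (hbd _) (hbd _)
    _ = ‖X‖ₑ ^ 2 * ∫⁻ u, (‖φ (fun x => (b x).re) u‖ₑ ^ 2 + ‖φ (fun x => (b x).im) u‖ₑ ^ 2) ∂T := by
        rw [lintegral_add_left hφm, mul_add]
    _ ≤ _ := mul_le_mul_right (lintegral_mono hpt) _

/-- The test functions vanishing on `A`. -/
def vanishingOn (A : Set (Rd d)) : Submodule ℝ (testSpace d) where
  carrier := {f | ∀ t ∈ A, f.1 t = 0}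
  add_mem' hf hg t ht := by simp [hf t ht, hg t ht]
  zero_mem' t _ := rfl
  smul_mem' c f hf t ht := by simp [hf t ht]

theorem isTestFun_indicator_monomialFun {A : Set (Rd d)} (hA : MeasurableSet A)
    (hAb : Bornology.IsBounded A) (m : Fin d →₀ ℕ) : IsTestFun (A.indicator (monomialFun m)) := by
  obtain ⟨R, hR0, hR⟩ := hAb.exists_pos_norm_le
  refine isTestFun_of_eq_zero_off ((measurable_monomialFun m).indicator hA)
    (C := R ^ multiLength m) (fun t => ?_) hAb fun t ht => Set.indicator_of_notMem ht _
  by_cases ht : t ∈ A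
  · rw [Set.indicator_of_mem ht]
    exact (abs_monomialFun_le m t).trans (pow_le_pow_left₀ (norm_nonneg _) (hR t ht) _)
  · rw [Set.indicator_of_notMem ht, abs_zero]; positivity

/-- An `L²` variable orthogonal to all statistics of test functions vanishing on `A` is orthogonal
to the moments of low degree on `A`. -/
theorem inner_statistic_monomial_eq_zero (hd : 0 < d) (hI : IsStationaryRandomMeasure P I)
    {S : Measure (Rd d)} (hS : IsSpectralMeasure P I S) {s : Rd d → ℝ≥0∞}
    (hs : IsSpectralDensity S s) {N : ℕ}
    (hN : ∀ ε : ℝ, 0 < ε → ∫⁻ u in Metric.ball (0 : Rd d) ε,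
      (radialSup s u)⁻¹ * ENNReal.ofReal (‖u‖ ^ (2 * N)) = ∞)
    {A : Set (Rd d)} (hA : MeasurableSet A) (hAb : Bornology.IsBounded A) {X : Lp ℝ 2 P}
    (hX : ∀ f ∈ vanishingOn A, inner ℝ X (statistic hI f) = 0) {m : Fin d →₀ ℕ}
    (hm : m.degree ≤ N) :
    inner ℝ X (statistic hI ⟨_, isTestFun_indicator_monomialFun hA hAb m⟩) = 0 := by
  obtain ⟨R, hAR⟩ := hAb.subset_closedBall (0 : Rd d)
  set K : Set (Rd d) := Metric.closedBall 0 R with hK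
  have : CompactSpace K := isCompact_iff_compactSpace.1 (isCompact_closedBall _ _)
  let Λ : C(K, ℝ) →L[ℝ] Lp ℝ 2 P :=
    ⟨(statistic hI).comp (extendZero hA hAR), continuous_statistic_extendZero hI hA hAR⟩
  let Lr : C(K, ℝ) →L[ℝ] ℝ := (innerSL ℝ X).comp Λ
  -- The complex-linear extension of the real functional: it agrees with `Lr` on real-valued
  -- functions.
  let L : C(K, ℂ) →L[ℂ] ℂ := StrongDual.extendRCLike
    (Lr.comp (Complex.reCLM.compLeftContinuous ℝ K))
  have hreal : ∀ (g : C(K, ℂ)) (g' : C(K, ℝ)), (∀ t, g t = (g' t : ℂ)) → L g = (Lr g' : ℂ) := by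
    intro g g' hg
    have h1 : Complex.reCLM.compLeftContinuous ℝ K g = g' := by
      ext t; simp [hg]
    have h2 : Complex.reCLM.compLeftContinuous ℝ K (Complex.I • g) = 0 := by
      ext t; simp [hg]
    have h3 := StrongDual.extendRCLike_apply (𝕜 := ℂ)
      (Lr.comp (Complex.reCLM.compLeftContinuous ℝ K)) g
    refine h3.trans ?_
    simp only [ContinuousLinearMap.comp_apply, RCLike.I_to_complex] at *
    rw [h1, h2]
    simp
  -- Here the orthogonality of `X` enters: changing a test function off `A` does not change the
  -- pairing, so window translates reaching outside `K` are seen only through their values on `A`.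
  have htest : ∀ (f : testSpace d) (g' : C(K, ℝ)), (∀ t (ht : t ∈ K), t ∈ A → f.1 t = g' ⟨t, ht⟩) →
      inner ℝ X (statistic hI f) = Lr g' := by
    intro f g' hfg
    have h1 := hX (f - extendZero hA hAR g') (fun t ht => by
      have := extendZero_apply_of_mem hA hAR g' ht
      simp only [Submodule.coe_sub, Pi.sub_apply]
      rw [this, hfg t (hAR ht) ht, sub_self])
    rw [map_sub, inner_sub_right, sub_eq_zero] at h1
    exact h1
  obtain ⟨f, hft, hfc, hfi, hfhc, hf0, hinv⟩ := exists_window (d := d)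
  let f' : testSpace d := ⟨f, hft⟩
  set c : ℝ := ((2 * Real.pi) ^ d)⁻¹ with hc
  have hc0 : 0 < c := by positivity
  have hwave : ∀ x, ((inner ℝ X (statistic hI (translateTest f' x)) : ℝ) : ℂ) =
      ∫ u, wave x u * (c * fourierHat f u * L (planeWave K u)) := by
    intro x
    let g' : C(K, ℝ) := ⟨fun t => f (t.1 - x), by fun_prop⟩
    let g : C(K, ℂ) := ⟨fun t => (f (t.1 - x) : ℂ), by fun_prop⟩
    rw [htest (translateTest f' x) g' fun t ht _ => rfl, ← hreal g g' fun t => rfl]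
    exact apply_translate_eq_integral L hfi hinv x g fun t => rfl
  set a : ℝ≥0∞ := ENNReal.ofReal ((∫ ω, I f'.1 ω ∂P) ^ 2) with ha
  have := isFiniteMeasure_windowedMeasure hI hS hft (a := a) ENNReal.ofReal_ne_top
  have hFi : Integrable fun u => (c * fourierHat f u * L (planeWave K u) : ℂ) := by
    refine (hfi.const_mul _).mul_bdd (c := ‖L‖)
      (L.continuous.comp continuous_planeWave).aestronglyMeasurable (ae_of_all _ fun u => ?_)
    exact (L.le_opNorm _).trans (mul_le_of_le_one_right (norm_nonneg _) (norm_planeWave_le u))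
  have hmono : L (monomialOn K m) = 0 := by
    refine apply_monomialOn_eq_zero hd hs hN hfi hfhc hf0 hc0 (a := a) L (A := ‖X‖ₑ)
      enorm_ne_top (fun b => ?_) hm
    have h1 := enorm_sum_inner_le hI hS f' hfhc.measurable X b
    refine le_trans (le_of_eq ?_) h1
    congr 1
    unfold trig Finsupp.sum
    simp only [hwave, Finset.sum_mul]
    rw [integral_finsetSum]
    · refine Finset.sum_congr rfl fun x _ => ?_
      rw [← integral_const_mul]
      refine integral_congr_ae (ae_of_all _ fun u => ?_)
      simp only []
      ring
    · intro x _
      have := (integrable_wave_mul x hFi).const_mul (b x)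
      refine this.congr (ae_of_all _ fun u => ?_)
      simp only []
      ring
  let μ' : C(K, ℝ) := ⟨fun t => monomialFun m t.1,
    (continuous_monomialFun m).comp continuous_subtype_val⟩
  rw [hreal _ μ' fun t => rfl] at hmono
  rw [htest _ μ' fun t ht htA => Set.indicator_of_mem htA _]
  exact_mod_cast hmono

/-- The closure of a subspace is its double orthogonal complement, so the orthogonality just proved
yields `L²` approximation; a subsequence then converges almost surely too. -/
theorem isMultiRigid_of_lintegral_eq_top (hd : 0 < d) (hI : IsStationaryRandomMeasure P I)
    {S : Measure (Rd d)} (hS : IsSpectralMeasure P I S) {s : Rd d → ℝ≥0∞}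
    (hs : IsSpectralDensity S s) {N : ℕ}
    (hN : ∀ ε : ℝ, 0 < ε → ∫⁻ u in Metric.ball (0 : Rd d) ε,
      (radialSup s u)⁻¹ * ENNReal.ofReal (‖u‖ ^ (2 * N)) = ∞)
    {A : Set (Rd d)} (hA : MeasurableSet A) (hAb : Bornology.IsBounded A) {m : Fin d →₀ ℕ}
    (hm : multiLength m ≤ N) : IsMultiRigid P I m A := by
  let γ : testSpace d := ⟨_, isTestFun_indicator_monomialFun hA hAb m⟩
  set W : Submodule ℝ (Lp ℝ 2 P) := (vanishingOn A).map (statistic hI) with hW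
  have hmem : statistic hI γ ∈ closure (W : Set (Lp ℝ 2 P)) := by
    rw [← Submodule.topologicalClosure_coe, ← Submodule.orthogonal_orthogonal_eq_closure]
    refine (Submodule.mem_orthogonal _ _).2 fun X hX => ?_
    refine inner_statistic_monomial_eq_zero hd hI hS hs hN hA hAb (fun f hf => ?_)
      (multiLength_eq_degree m ▸ hm)
    rw [real_inner_comm]
    exact (Submodule.mem_orthogonal _ _).1 hX _ (Submodule.mem_map_of_mem hf)
  obtain ⟨w, hw, hlim⟩ := mem_closure_iff_seq_limit.1 hmem
  choose h hhA hhw using fun n => Submodule.mem_map.1 (hw n)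
  obtain ⟨ns, hns, hae⟩ := (tendstoInMeasure_of_tendsto_Lp hlim).exists_seq_tendsto_ae
  refine ⟨fun n => (h (ns n)).1, fun n => ⟨(h (ns n)).2, hhA (ns n)⟩, ?_, ?_⟩
  · have h1 := (tendsto_iff_edist_tendsto_0.1 hlim).comp hns.tendsto_atTop
    refine h1.congr fun n => ?_
    rw [Function.comp_apply, ← hhw, Lp.edist_def]
    exact eLpNorm_congr_ae ((coeFn_statistic hI _).sub (coeFn_statistic hI γ))
  · have h2 : ∀ᵐ ω ∂P, ∀ n, w n ω = I (h n).1 ω := ae_all_iff.2 fun n => by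
      rw [← hhw]; exact coeFn_statistic hI _
    filter_upwards [hae, h2, coeFn_statistic hI γ] with ω h3 h4 h5
    rw [h5] at h3
    simpa only [h4] using h3

end Rigidity

theorem proposition3p4 {d : ℕ} (hd : 0 < d) {Ω : Type*} [MeasurableSpace Ω] (P : Measure Ω)
    [IsProbabilityMeasure P] (I : (Rd d → ℝ) → Ω → ℝ) (hI : IsStationaryRandomMeasure P I)
    (S : Measure (Rd d)) (hS : IsSpectralMeasure P I S)
    (s : Rd d → ℝ≥0∞) (hs : IsSpectralDensity S s) (k : Fin d →₀ ℕ) :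
    -- the two forms of the integral condition are equivalent
    (∀ ε : ℝ, 0 < ε →
      (∫⁻ u in Metric.ball (0 : Rd d) ε,
          (radialSup s u)⁻¹ * ENNReal.ofReal (monomialFun (2 • k) u) = ∞ ↔
        ∫⁻ u in Metric.ball (0 : Rd d) ε,
          (radialSup s u)⁻¹ * ENNReal.ofReal (‖u‖ ^ (2 * multiLength k)) = ∞)) ∧
    -- the integral condition gives poles and rigidity, at order `k` and every order of length at most `|k|`
    ((∀ ε : ℝ, 0 < ε →
        ∫⁻ u in Metric.ball (0 : Rd d) ε,
          (radialSup s u)⁻¹ * ENNReal.ofReal (‖u‖ ^ (2 * multiLength k)) = ∞) →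
      ∀ m : Fin d →₀ ℕ, multiLength m ≤ multiLength k →
        HasPoleOfOrder (fun u => (s u)⁻¹) m ∧
        ∀ A : Set (Rd d), Bornology.IsBounded A → MeasurableSet A → IsMultiRigid P I m A) ∧
    -- for an isotropic density the supremum over the sphere is the density itself
    (IsIsotropic s →
      radialSup s = s ∧
      ((∀ ε : ℝ, 0 < ε →
          ∫⁻ u in Metric.ball (0 : Rd d) ε, (s u)⁻¹ * ENNReal.ofReal (monomialFun (2 • k) u) = ∞) →
        ∀ m : Fin d →₀ ℕ, multiLength m ≤ multiLength k →
          HasPoleOfOrder (fun u => (s u)⁻¹) m ∧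
          ∀ A : Set (Rd d), Bornology.IsBounded A → MeasurableSet A → IsMultiRigid P I m A)) := by
  have h1 : ∀ ε : ℝ, _ := fun ε => setLIntegral_monomial_eq_top_iff hd
    (w := fun u => (radialSup s u)⁻¹) (fun u v huv => congrArg (·⁻¹) (radialSup_radial s u v huv)) k ε
  have h2 : (∀ ε : ℝ, 0 < ε → ∫⁻ u in Metric.ball (0 : Rd d) ε,
        (radialSup s u)⁻¹ * ENNReal.ofReal (‖u‖ ^ (2 * multiLength k)) = ∞) →
      ∀ m : Fin d →₀ ℕ, multiLength m ≤ multiLength k →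
        HasPoleOfOrder (fun u => (s u)⁻¹) m ∧
        ∀ A : Set (Rd d), Bornology.IsBounded A → MeasurableSet A → IsMultiRigid P I m A :=
    fun hN m hm => ⟨hasPoleOfOrder_inv hd s hN hm, fun A hAb hA =>
      isMultiRigid_of_lintegral_eq_top hd hI hS hs hN hA hAb hm⟩
  refine ⟨fun ε _ => h1 ε, h2, fun hiso => ?_⟩
  have hrad := radialSup_eq_of_isotropic hiso
  refine ⟨hrad, fun hk => h2 fun ε hε => (h1 ε).1 ?_⟩
  rw [hrad]
  exact hk ε hε
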